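/- Let $X$ be a proper geodesic metric space. A proper ray in a metric space $Y$ with base point $y_0$ is a continuous map $\gamma:[0,\infty)\to Y$ such that $\gamma^{-1}(B(y_0,r))$ is bounded for every $r\ge 0$, where $B(y_0,r)$ is the closed ball. Two proper rays $\gamma_1,\gamma_2$ converge to the same end if for every $r\ge 0$ there is $t\ge 0$ such that $\gamma_1([t,\infty))$ and $\gamma_2([t,\infty))$ are contained in the same path component of $Y\setminus B(y_0,r)$. The space $\mathrm{Ends}(Y)$ is the set of equivalence classes $\mathrm{end}(\gamma)$ of proper rays $\gamma$. A sequence $\mathrm{end}(\gamma_n)$ converges to $\mathrm{end}(\gamma)$ if for every $r\ge 0$ there are numbers $N_n\ge 0$ such that, for all sufficiently large $n$, $\gamma_n([N_n,\infty))$ and $\gamma([N_n,\infty))$ are contained in the same path component of $Y\setminus B(y_0,r)$; a subset of $\mathrm{Ends}(Y)$ is closed if and only if it contains every limit of every convergent sequence of its elements. A simplicial tree is a connected simplicial complex of dimension at most $1$ that is an $\mathbb{R}$-tree for the path metric in which every edge is isometric to $[0,1]$; here an $\mathbb{R}$-tree is a metric space in which any two points are joined by a topologically embedded interval that is unique up to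 reparametrisation and is a geodesic. It is locally finite if every vertex has finitely many neighbours. Then there exists a locally finite simplicial tree $T$ such that, for every choice of base points in $X$ and in $T$, $\mathrm{Ends}(X)$ is homeomorphic to $\mathrm{Ends}(T)$. -/

import Mathlib

open Set Filter Topology Metric
open scoped NNReal

universe u v

/-- `α` restricted to `[0, dist x y]` is a geodesic from `x` to `y`. -/
def IsGeodesicFromTo {X : Type u} [MetricSpace X] (α : ℝ → X) (x y : X) : Prop :=
  α 0 = x ∧ α (dist x y) = y ∧
    ∀ s ∈ Icc (0 : ℝ) (dist x y), ∀ t ∈ Icc (0 : ℝ) (dist x y), dist (α s) (α t) = |s - t|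

/-- A geodesic metric space: any two points are joined by a geodesic. -/
def IsGeodesicSpace (X : Type u) [MetricSpace X] : Prop :=
  ∀ x y : X, ∃ α : ℝ → X, IsGeodesicFromTo α x y

/-- An `ℝ`-tree: any two points are joined by a topologically embedded interval, which is unique
(up to reparametrisation, that is, as a subset), and it is a geodesic. -/
def IsRTree (T : Type u) [MetricSpace T] : Prop :=
  ∀ x y : T, ∃ α : ℝ → T, IsGeodesicFromTo α x y ∧
    ∀ (r : ℝ) (β : ℝ → T), 0 ≤ r → β 0 = x → β r = y →
      IsEmbedding ((Icc (0 : ℝ) r).domRestrict β) →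
        β '' Icc (0 : ℝ) r = α '' Icc (0 : ℝ) (dist x y)

/-! ### The space of ends of a metric space with a base point -/

section Ends

variable {X : Type u} [MetricSpace X]

/-- A proper ray: a continuous map `[0, ∞) → X` such that the preimage of every closed ball around
the base point is bounded. -/
structure ProperRay (X : Type u) [MetricSpace X] (x₀ : X) where
  toFun : ℝ≥0 → X
  continuous_toFun : Continuous toFun
  isBounded_preimage : ∀ r : ℝ, 0 ≤ r → Bornology.IsBounded (toFun ⁻¹' closedBall x₀ r)

/-- The sets `A` and `B` are contained in the same path component of the complement of the closed
ball of radius `r` around `x₀`. -/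
def InSamePathComponent (x₀ : X) (r : ℝ) (A B : Set X) : Prop :=
  ∃ z ∈ (closedBall x₀ r)ᶜ,
    A ⊆ pathComponentIn (closedBall x₀ r)ᶜ z ∧ B ⊆ pathComponentIn (closedBall x₀ r)ᶜ z

theorem pathComponentIn_eq_of_mem_both {F : Set X} {z w a : X}
    (hz : a ∈ pathComponentIn F z) (hw : a ∈ pathComponentIn F w) :
    pathComponentIn F z = pathComponentIn F w := by
  have h : JoinedIn F z w := JoinedIn.trans hz (JoinedIn.symm hw)
  ext b
  exact ⟨fun hb => h.symm.trans hb, fun hb => h.trans hb⟩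

/-- Two proper rays converge to the same end. -/
def ProperRay.SameEnd {x₀ : X} (γ₁ γ₂ : ProperRay X x₀) : Prop :=
  ∀ r : ℝ, 0 ≤ r → ∃ t : ℝ≥0,
    InSamePathComponent x₀ r (γ₁.toFun '' Ici t) (γ₂.toFun '' Ici t)

theorem ProperRay.exists_tail {x₀ : X} (γ : ProperRay X x₀) (r : ℝ) (hr : 0 ≤ r) :
    ∃ t : ℝ≥0, ∀ s, t ≤ s → γ.toFun s ∈ (closedBall x₀ r)ᶜ := by
  obtain ⟨C, hC⟩ := (γ.isBounded_preimage r hr).subset_closedBall (0 : ℝ≥0)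
  refine ⟨(C + 1).toNNReal, fun s hs hmem => ?_⟩
  have h1 := hC hmem
  rw [mem_closedBall, NNReal.dist_eq] at h1
  have h2 : C + 1 ≤ (s : ℝ) := Real.toNNReal_le_iff_le_coe.1 hs
  have h3 := le_abs_self ((s : ℝ) - ((0 : ℝ≥0) : ℝ))
  simp only [NNReal.coe_zero, sub_zero] at h1 h3
  linarith

theorem ProperRay.SameEnd.refl {x₀ : X} (γ : ProperRay X x₀) : γ.SameEnd γ := by
  intro r hr
  obtain ⟨t, ht⟩ := γ.exists_tail r hr
  have key : γ.toFun '' Ici t ⊆ pathComponentIn (closedBall x₀ r)ᶜ (γ.toFun t) := by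
    have hpc : IsPathConnected (γ.toFun '' Ici t) := by
      have h : IsPathConnected (Ici t) := by
        have h0 : (fun x : ℝ => x.toNNReal) '' Ici (t : ℝ) = Ici t := by
          ext s
          simp only [mem_image, mem_Ici]
          constructor
          · rintro ⟨x, hx, rfl⟩
            exact NNReal.le_toNNReal_of_coe_le hx
          · intro hs
            exact ⟨s, NNReal.coe_le_coe.2 hs, Real.toNNReal_coe⟩
        rw [← h0]
        exact ((convex_Ici (t : ℝ)).isPathConnected nonempty_Ici).image continuous_real_toNNReal
      exact h.image γ.continuous_toFun
    refine hpc.subset_pathComponentIn ⟨t, self_mem_Ici, rfl⟩ ?_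
    rintro _ ⟨s, hs, rfl⟩
    exact ht s hs
  exact ⟨t, γ.toFun t, ht t le_rfl, key, key⟩

theorem ProperRay.SameEnd.symm {x₀ : X} {γ₁ γ₂ : ProperRay X x₀} (h : γ₁.SameEnd γ₂) :
    γ₂.SameEnd γ₁ := by
  intro r hr
  obtain ⟨t, z, hz, h1, h2⟩ := h r hr
  exact ⟨t, z, hz, h2, h1⟩

theorem ProperRay.SameEnd.trans {x₀ : X} {γ₁ γ₂ γ₃ : ProperRay X x₀}
    (h : γ₁.SameEnd γ₂) (h' : γ₂.SameEnd γ₃) : γ₁.SameEnd γ₃ := by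
  intro r hr
  obtain ⟨t, z, hz, h1, h2⟩ := h r hr
  obtain ⟨t', z', -, h2', h3⟩ := h' r hr
  have heq := pathComponentIn_eq_of_mem_both
    (h2 (mem_image_of_mem _ (mem_Ici.2 (le_max_left t t'))))
    (h2' (mem_image_of_mem _ (mem_Ici.2 (le_max_right t t'))))
  refine ⟨max t t', z, hz, ?_, ?_⟩
  · exact (image_mono (Ici_subset_Ici.2 (le_max_left _ _))).trans h1
  · rw [heq]
    exact (image_mono (Ici_subset_Ici.2 (le_max_right _ _))).trans h3

/-- Converging to the same end is an equivalence relation on proper rays. -/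
instance ProperRay.setoid (X : Type u) [MetricSpace X] (x₀ : X) : Setoid (ProperRay X x₀) where
  r := ProperRay.SameEnd
  iseqv := ⟨ProperRay.SameEnd.refl, ProperRay.SameEnd.symm, ProperRay.SameEnd.trans⟩

/-- The space of ends: equivalence classes of proper rays. -/
def SpaceOfEnds (X : Type u) [MetricSpace X] (x₀ : X) : Type u :=
  Quotient (ProperRay.setoid X x₀)

/-- The end of a proper ray. -/
def ProperRay.toEnd {x₀ : X} (γ : ProperRay X x₀) : SpaceOfEnds X x₀ :=
  Quotient.mk (ProperRay.setoid X x₀) γ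

/-- Convergence of a sequence of ends: `e n = end (γ n)`, `e' = end γ'`, and for every `r` there are
`N n` such that, for all large `n`, the tails of `γ n` and `γ'` from time `N n` on lie in the same
path component of the complement of the closed ball of radius `r`. (Whether this holds does not
depend on the representatives.) -/
def SpaceOfEnds.ConvergesTo {x₀ : X} (e : ℕ → SpaceOfEnds X x₀) (e' : SpaceOfEnds X x₀) : Prop :=
  ∃ (γ : ℕ → ProperRay X x₀) (γ' : ProperRay X x₀),
    (∀ n, (γ n).toEnd = e n) ∧ γ'.toEnd = e' ∧
    ∀ r : ℝ, 0 ≤ r → ∃ N : ℕ → ℝ≥0, ∀ᶠ n in atTop,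
      InSamePathComponent x₀ r ((γ n).toFun '' Ici (N n)) (γ'.toFun '' Ici (N n))

theorem SpaceOfEnds.ConvergesTo.subseq {x₀ : X} {e : ℕ → SpaceOfEnds X x₀}
    {e' : SpaceOfEnds X x₀} (h : SpaceOfEnds.ConvergesTo e e') {φ : ℕ → ℕ} (hφ : StrictMono φ) :
    SpaceOfEnds.ConvergesTo (e ∘ φ) e' := by
  obtain ⟨γ, γ', h1, h2, h3⟩ := h
  refine ⟨γ ∘ φ, γ', fun n => h1 (φ n), h2, fun r hr => ?_⟩
  obtain ⟨N, hN⟩ := h3 r hr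
  exact ⟨N ∘ φ, hφ.tendsto_atTop.eventually hN⟩

/-- The topology induced by convergence of sequences of ends: a set of ends is closed if and only if
it contains the limits of all convergent sequences of its elements. -/
instance SpaceOfEnds.topologicalSpace (X : Type u) [MetricSpace X] (x₀ : X) :
    TopologicalSpace (SpaceOfEnds X x₀) where
  IsOpen U := ∀ (e : ℕ → SpaceOfEnds X x₀) (e' : SpaceOfEnds X x₀),
    (∀ n, e n ∈ Uᶜ) → SpaceOfEnds.ConvergesTo e e' → e' ∈ Uᶜ
  isOpen_univ e _ h _ := absurd (mem_univ (e 0)) (h 0)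
  isOpen_inter U V hU hV e e' h hc := by
    have h' : ∀ n, e n ∈ Uᶜ ∨ e n ∈ Vᶜ := fun n => by
      have := h n
      rwa [compl_inter] at this
    rw [compl_inter]
    by_cases hf : ∃ᶠ n in atTop, e n ∈ Uᶜ
    · obtain ⟨φ, hφ, hφU⟩ := extraction_of_frequently_atTop hf
      exact Or.inl (hU (e ∘ φ) e' hφU (hc.subseq hφ))
    · obtain ⟨φ, hφ, hφV⟩ := extraction_of_frequently_atTop
        ((not_frequently.1 hf).mono fun n hn => (h' n).resolve_left hn).frequently
      exact Or.inr (hV (e ∘ φ) e' hφV (hc.subseq hφ))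
  isOpen_sUnion S hS e e' h hc := by
    rintro ⟨U, hU, he'⟩
    exact hS U hU e e' (fun n hn => h n ⟨U, hU, hn⟩) hc he'

theorem SpaceOfEnds.isClosed_iff {x₀ : X} (C : Set (SpaceOfEnds X x₀)) :
    IsClosed C ↔ ∀ (e : ℕ → SpaceOfEnds X x₀) (e' : SpaceOfEnds X x₀),
      (∀ n, e n ∈ C) → SpaceOfEnds.ConvergesTo e e' → e' ∈ C := by
  rw [← isOpen_compl_iff]
  change (∀ (e : ℕ → SpaceOfEnds X x₀) (e' : SpaceOfEnds X x₀),
    (∀ n, e n ∈ Cᶜᶜ) → SpaceOfEnds.ConvergesTo e e' → e' ∈ Cᶜᶜ) ↔ _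
  rw [compl_compl]

end Ends

/-! ### The geometric realisation of a connected graph, with the path metric -/

section Realisation

variable {V : Type v}

open Classical in
/-- The vertex `a` as a point with barycentric coordinates. -/
noncomputable def vertexCoord (a : V) : V → ℝ := Pi.single a 1

/-- The geometric realisation of a connected 1-dimensional simplicial complex (a simple graph), in
barycentric coordinates: its points are the vertices and the points of the closed edges. -/
@[ext]
structure MetricGraph (G : SimpleGraph V) (hG : G.Connected) where
  coord : V → ℝ
  mem_simplex : (∃ a, coord = vertexCoord a) ∨
    ∃ a b, G.Adj a b ∧ coord ∈ segment ℝ (vertexCoord a) (vertexCoord b)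

namespace MetricGraph

variable {G : SimpleGraph V} {hG : G.Connected}

/-- The vertex `a` of the realisation. -/
noncomputable def vertex (hG : G.Connected) (a : V) : MetricGraph G hG :=
  ⟨vertexCoord a, Or.inl ⟨a, rfl⟩⟩

/-- The point `p` lies on the closed edge with endpoints `a` and `b`. -/
def OnEdge (p : MetricGraph G hG) (a b : V) : Prop :=
  G.Adj a b ∧ p.coord ∈ segment ℝ (vertexCoord a) (vertexCoord b)

/-- `HasPath p q L`: there is a piecewise linear path of length `L` from `p` to `q`. Each of its
pieces lies in one closed edge, where lengths are measured by a barycentric coordinate, so that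
every edge is isometric to `[0, 1]`. -/
inductive HasPath : MetricGraph G hG → MetricGraph G hG → ℝ → Prop
  | nil (p : MetricGraph G hG) : HasPath p p 0
  | cons {p q r : MetricGraph G hG} {L : ℝ} (a b : V) (hp : p.OnEdge a b) (hq : q.OnEdge a b)
      (h : HasPath q r L) : HasPath p r (|p.coord a - q.coord a| + L)

theorem HasPath.nonneg {p q : MetricGraph G hG} {L : ℝ} (h : HasPath p q L) : 0 ≤ L := by
  induction h with
  | nil p => exact le_rfl
  | cons a b hp hq h ih => positivity

theorem HasPath.trans {p q r : MetricGraph G hG} {L M : ℝ} (h : HasPath p q L)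
    (h' : HasPath q r M) : HasPath p r (L + M) := by
  induction h with
  | nil p => rwa [zero_add]
  | cons a b hp hq h ih =>
    rw [add_assoc]
    exact HasPath.cons a b hp hq (ih h')

theorem HasPath.symm {p q : MetricGraph G hG} {L : ℝ} (h : HasPath p q L) : HasPath q p L := by
  induction h with
  | nil p => exact HasPath.nil p
  | cons a b hp hq h ih =>
    have h1 := ih.trans (HasPath.cons a b hq hp (HasPath.nil _))
    rwa [abs_sub_comm, add_zero, add_comm] at h1

theorem onEdge_vertex_left {a b : V} (h : G.Adj a b) : (vertex hG a).OnEdge a b :=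
  ⟨h, left_mem_segment _ _ _⟩

theorem onEdge_vertex_right {a b : V} (h : G.Adj a b) : (vertex hG b).OnEdge a b :=
  ⟨h, right_mem_segment _ _ _⟩

theorem exists_hasPath_vertex (p : MetricGraph G hG) : ∃ a L, HasPath p (vertex hG a) L := by
  rcases p.mem_simplex with ⟨a, ha⟩ | ⟨a, b, hab, hp⟩
  · refine ⟨a, 0, ?_⟩
    have : p = vertex hG a := MetricGraph.ext ha
    rw [this]
    exact HasPath.nil _
  · exact ⟨a, _, HasPath.cons a b ⟨hab, hp⟩ (onEdge_vertex_left hab) (HasPath.nil _)⟩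

theorem exists_hasPath (p q : MetricGraph G hG) : ∃ L, HasPath p q L := by
  obtain ⟨a, L, hL⟩ := exists_hasPath_vertex p
  obtain ⟨b, M, hM⟩ := exists_hasPath_vertex q
  obtain ⟨w⟩ := hG.preconnected a b
  have hw : ∃ K, HasPath (vertex hG a) (vertex hG b) K := by
    clear hL hM
    induction w with
    | nil => exact ⟨0, HasPath.nil _⟩
    | cons h w ih =>
      obtain ⟨K, hK⟩ := ih
      exact ⟨_, HasPath.cons _ _ (onEdge_vertex_left h) (onEdge_vertex_right h) hK⟩
  obtain ⟨K, hK⟩ := hw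
  exact ⟨_, (hL.trans hK).trans hM.symm⟩

theorem abs_coord_sub_le_of_onEdge {p q : MetricGraph G hG} {a b : V} (hp : p.OnEdge a b)
    (hq : q.OnEdge a b) (c : V) : |p.coord c - q.coord c| ≤ |p.coord a - q.coord a| := by
  classical
  obtain ⟨hab, s, s', hs, hs', hss, hps⟩ := hp
  obtain ⟨-, t, t', ht, ht', htt, hqt⟩ := hq
  have hne : a ≠ b := hab.ne
  have hpc : ∀ c, p.coord c = s * vertexCoord a c + s' * vertexCoord b c := fun c => by
    rw [← hps]; rfl
  have hqc : ∀ c, q.coord c = t * vertexCoord a c + t' * vertexCoord b c := fun c => by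
    rw [← hqt]; rfl
  have hv : ∀ a c : V, vertexCoord a c = if c = a then 1 else 0 := fun a c => by
    simp [vertexCoord, Pi.single_apply]
  rw [hpc, hqc, hpc, hqc]
  simp only [hv, if_neg hne, if_true, mul_one, mul_zero, add_zero]
  by_cases hca : c = a
  · subst hca
    simp [hne]
  · by_cases hcb : c = b
    · subst hcb
      have h1 : s' - t' = -(s - t) := by linarith
      simp [hca, h1, abs_sub_comm]
    · simp [hca, hcb]

theorem HasPath.abs_coord_sub_le {p q : MetricGraph G hG} {L : ℝ} (h : HasPath p q L) (c : V) :
    |p.coord c - q.coord c| ≤ L := by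
  induction h with
  | nil p => simp
  | cons a b hp hq h ih =>
    exact (abs_sub_le _ _ _).trans (add_le_add (abs_coord_sub_le_of_onEdge hp hq c) ih)

/-- The path metric: the distance of two points is the infimum of the lengths of the paths between
them. -/
noncomputable def pathDist (p q : MetricGraph G hG) : ℝ := sInf {L | HasPath p q L}

theorem pathDist_le {p q : MetricGraph G hG} {L : ℝ} (h : HasPath p q L) : pathDist p q ≤ L :=
  csInf_le ⟨0, fun _ hM => hM.nonneg⟩ h

theorem le_pathDist {p q : MetricGraph G hG} {K : ℝ} (h : ∀ L, HasPath p q L → K ≤ L) :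
    K ≤ pathDist p q :=
  le_csInf (exists_hasPath p q) h

theorem pathDist_comm_le (p q : MetricGraph G hG) : pathDist p q ≤ pathDist q p :=
  le_pathDist fun _ h => pathDist_le h.symm

noncomputable instance : MetricSpace (MetricGraph G hG) where
  dist := pathDist
  dist_self p := le_antisymm (pathDist_le (HasPath.nil p)) (le_pathDist fun _ h => h.nonneg)
  dist_comm p q := le_antisymm (pathDist_comm_le p q) (pathDist_comm_le q p)
  dist_triangle p q r := by
    rw [← sub_le_iff_le_add]
    refine le_pathDist fun L hL => ?_
    rw [sub_le_iff_le_add, ← sub_le_iff_le_add']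
    refine le_pathDist fun M hM => ?_
    rw [sub_le_iff_le_add']
    exact pathDist_le (hL.trans hM)
  eq_of_dist_eq_zero {p q} h := by
    change pathDist p q = 0 at h
    refine MetricGraph.ext (funext fun c => ?_)
    have h1 : |p.coord c - q.coord c| ≤ pathDist p q :=
      le_pathDist fun _ hL => hL.abs_coord_sub_le c
    rw [h] at h1
    exact sub_eq_zero.1 (abs_eq_zero.1 (le_antisymm h1 (abs_nonneg _)))

theorem dist_eq_pathDist (p q : MetricGraph G hG) : dist p q = pathDist p q := rfl

end MetricGraph

end Realisation

/-! The tree records how the complement of a growing ball around a base point `o` breaks up. Its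
vertices of level `n` are the path components of `X \ B(o, n - 1)` that contain a point at distance
at least `n` from `o`; the parent of a component is the component one level lower that contains it.
A geodesic towards `o` moves such a point onto the sphere of radius `n`, which is compact since `X`
is proper, and points of that sphere less than `1` apart lie in the same component. So every level
is finite, and the tree is locally finite.

A proper ray eventually stays in one component of each level and so determines an infinite ascending
branch. Rays have the same end exactly when their branches agree, every branch comes from a ray, and
ends converge exactly when their branches eventually agree at each level. `ComponentTree` isolates
the properties of components that this uses, so `ComponentTree.homeomorph` identifies the ends of
any two spaces with the same tree. It is applied to `X` (`IsGeodesicSpace.componentTree`) and to the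
realisation of the tree itself (`LeveledTree.componentTree`).

That the realisation is an `ℝ`-tree (`LeveledTree.isRTree`) is shown by means of the height of a
point and its truncation `below` to a given height. By `exists_below_eq_of_hasPath` a path must come
down to a common ancestor, so distances are `ht p + ht q - 2 * m`, with `m` the height of the
highest common ancestor. -/

/-! ### Rooted trees and their ancestors -/

/-- A rooted tree, given by its level function and the map that sends a vertex to its parent
(and the root to itself). -/
structure LeveledTree (V : Type v) where
  root : V
  par : V → V
  lev : V → ℕ
  lev_root : lev root = 0
  lev_par : ∀ v, lev (par v) = lev v - 1
  eq_root : ∀ v, lev v = 0 → v = root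

namespace LeveledTree

variable {V : Type v} (T : LeveledTree V)

theorem par_root : T.par T.root = T.root :=
  T.eq_root _ (by rw [T.lev_par, T.lev_root])

/-- The graph that joins every vertex with its parent. -/
def graph : SimpleGraph V where
  Adj a b := a ≠ b ∧ (T.par a = b ∨ T.par b = a)
  symm := ⟨fun _ _ h => ⟨h.1.symm, h.2.symm⟩⟩
  loopless := ⟨fun _ h => h.1 rfl⟩

theorem par_ne {v : V} (h : T.lev v ≠ 0) : v ≠ T.par v := by
  intro h'
  have := T.lev_par v
  rw [← h'] at this
  omega

theorem adj_par {v : V} (h : T.lev v ≠ 0) : T.graph.Adj v (T.par v) :=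
  ⟨T.par_ne h, Or.inl rfl⟩

theorem lev_ne_zero_of_adj {v : V} (h : T.graph.Adj v (T.par v)) : T.lev v ≠ 0 := by
  intro h0
  have := T.eq_root v h0
  subst this
  exact h.1 T.par_root.symm

theorem reachable_root (v : V) : T.graph.Reachable v T.root := by
  induction hn : T.lev v generalizing v with
  | zero => rw [T.eq_root v hn]
  | succ n ih =>
    exact (T.adj_par (by omega)).reachable.trans (ih _ (by rw [T.lev_par, hn]; rfl))

theorem graph_connected : T.graph.Connected :=
  { preconnected := fun a b => (T.reachable_root a).trans (T.reachable_root b).symm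
    nonempty := ⟨T.root⟩ }

/-- Neighbours are parents or children, so their levels are at most `lev a + 1`. -/
theorem finite_neighborSet (h : ∀ n, {v | T.lev v = n}.Finite) (a : V) :
    (T.graph.neighborSet a).Finite := by
  refine ((Set.finite_Iic (T.lev a + 1)).biUnion fun n _ => h n).subset fun b hb => ?_
  simp only [mem_iUnion, mem_ofPred_eq, mem_Iic, exists_prop, exists_eq_right']
  have h1 := T.lev_par a
  have h2 := T.lev_par b
  rcases hb.2 with h | h
  · rw [← h]
    omega
  · rw [h] at h2
    omega

/-- The ancestor of `v` at level `n` (or `v` itself if its level is at most `n`). -/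
def anc (v : V) (n : ℕ) : V := T.par^[T.lev v - n] v

theorem lev_iterate (v : V) (k : ℕ) : T.lev (T.par^[k] v) = T.lev v - k := by
  induction k with
  | zero => rfl
  | succ k ih => rw [Function.iterate_succ_apply', T.lev_par, ih]; omega

theorem lev_anc (v : V) (n : ℕ) : T.lev (T.anc v n) = min n (T.lev v) := by
  rw [anc, lev_iterate]; omega

theorem anc_of_le {v : V} {n : ℕ} (h : T.lev v ≤ n) : T.anc v n = v := by
  rw [anc, Nat.sub_eq_zero_of_le h]; rfl

theorem anc_anc (v : V) {k n : ℕ} (h : k ≤ n) : T.anc (T.anc v n) k = T.anc v k := by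
  rw [anc, lev_anc, anc, anc, ← Function.iterate_add_apply]
  congr 2; omega

theorem par_anc {v : V} {n : ℕ} (h : n < T.lev v) : T.par (T.anc v (n + 1)) = T.anc v n := by
  rw [anc, anc, ← Function.iterate_succ_apply' T.par]
  congr 2; omega

/-! ### Points of the realisation, by height -/

/-- The realisation of the tree. -/
abbrev Realisation := MetricGraph T.graph T.graph_connected

/-- `s - (lev u - 1)`, clamped to `[0, 1]`. -/
def edgeParam (u : V) (s : ℝ) : ℝ := max 0 (min 1 (s - T.lev u + 1))

theorem edgeParam_nonneg (u : V) (s : ℝ) : 0 ≤ T.edgeParam u s := le_max_left _ _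

theorem edgeParam_le_one (u : V) (s : ℝ) : T.edgeParam u s ≤ 1 :=
  max_le zero_le_one (min_le_left _ _)

theorem edgeParam_eq {u : V} {s : ℝ} (h1 : (T.lev u : ℝ) - 1 ≤ s) (h2 : s ≤ T.lev u) :
    T.edgeParam u s = s - T.lev u + 1 := by
  rw [edgeParam, min_eq_right (by linarith), max_eq_right (by linarith)]

theorem edgeParam_eq_one {u : V} {s : ℝ} (h : T.lev u ≤ s) : T.edgeParam u s = 1 := by
  rw [edgeParam, min_eq_left (by linarith), max_eq_right zero_le_one]

theorem edge_mem_segment (u : V) (s : ℝ) :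
    T.edgeParam u s • vertexCoord u + (1 - T.edgeParam u s) • vertexCoord (T.par u) ∈
      segment ℝ (vertexCoord u) (vertexCoord (T.par u)) :=
  ⟨_, _, T.edgeParam_nonneg u s, sub_nonneg.2 (T.edgeParam_le_one u s), by ring, rfl⟩

/-- The point of height `s` on the closed edge between `u` and its parent. -/
noncomputable def edgePoint (u : V) (s : ℝ) : T.Realisation where
  coord := T.edgeParam u s • vertexCoord u + (1 - T.edgeParam u s) • vertexCoord (T.par u)
  mem_simplex := by
    by_cases h : T.lev u = 0
    · refine Or.inl ⟨u, ?_⟩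
      rw [T.eq_root u h, T.par_root, ← add_smul]
      simp
    · exact Or.inr ⟨u, T.par u, T.adj_par h, T.edge_mem_segment u s⟩

theorem onEdge_edgePoint {u : V} (h : T.lev u ≠ 0) (s : ℝ) :
    (T.edgePoint u s).OnEdge u (T.par u) :=
  ⟨T.adj_par h, T.edge_mem_segment u s⟩

theorem vertexCoord_self (a : V) : vertexCoord a a = 1 := by simp [vertexCoord]

theorem vertexCoord_of_ne {a b : V} (h : b ≠ a) : vertexCoord a b = 0 := by
  simp [vertexCoord, h]

theorem edgePoint_coord_self {u : V} (h : T.lev u ≠ 0) (s : ℝ) :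
    (T.edgePoint u s).coord u = T.edgeParam u s := by
  simp [edgePoint, vertexCoord_self, vertexCoord_of_ne (T.par_ne h)]

theorem edgePoint_of_lev_le {u : V} {s : ℝ} (h : T.lev u ≤ s) :
    T.edgePoint u s = MetricGraph.vertex _ u := by
  ext1
  simp [edgePoint, T.edgeParam_eq_one h, MetricGraph.vertex]

theorem edgePoint_of_lev_eq_zero {u : V} (h : T.lev u = 0) (s : ℝ) :
    T.edgePoint u s = MetricGraph.vertex _ u := by
  ext1
  have : T.par u = u := by rw [T.eq_root u h, T.par_root]
  simp only [edgePoint, this, ← add_smul, MetricGraph.vertex]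
  simp

theorem edgePoint_of_le_lev_sub_one {u : V} {s : ℝ} (h : s ≤ (T.lev u : ℝ) - 1) :
    T.edgePoint u s = MetricGraph.vertex _ (T.par u) := by
  ext1
  have : T.edgeParam u s = 0 := by
    rw [edgeParam, min_eq_right (by linarith), max_eq_left (by linarith)]
  simp [edgePoint, this, MetricGraph.vertex]

/-- The point of height `s` on the geodesic from the root to the vertex `v`. -/
noncomputable def ray (v : V) (s : ℝ) : T.Realisation := T.edgePoint (T.anc v ⌈s⌉₊) s

/-- The ceiling in `ray` selects one edge. At an integer height the next edge up is equally good,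
and this lemma gives the freedom to use either. -/
theorem ray_eq_edgePoint (v : V) {s : ℝ} {n : ℕ} (h1 : (n : ℝ) ≤ s + 1) (h2 : s ≤ n) :
    T.ray v s = T.edgePoint (T.anc v n) s := by
  rcases (Nat.ceil_le.2 h2).eq_or_lt with h | h
  · rw [ray, h]
  · have hn : n = ⌈s⌉₊ + 1 := by
      refine le_antisymm ?_ h
      have : (n : ℝ) ≤ ((⌈s⌉₊ + 1 : ℕ) : ℝ) := by
        push_cast; linarith [Nat.le_ceil s]
      exact_mod_cast this
    rw [ray, hn]
    rcases lt_or_ge ⌈s⌉₊ (T.lev v) with hv | hv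
    · have hs : (⌈s⌉₊ : ℝ) ≤ s := by rw [hn] at h1; push_cast at h1; linarith
      rw [T.edgePoint_of_lev_le, T.edgePoint_of_le_lev_sub_one, T.par_anc hv]
      · rw [lev_anc, min_eq_left (by omega)]
        push_cast
        linarith [Nat.le_ceil s]
      · rw [lev_anc, min_eq_left (by omega)]
        exact hs
    · rw [T.anc_of_le hv, T.anc_of_le (by omega)]

theorem ray_natCast (v : V) (n : ℕ) :
    T.ray v n = MetricGraph.vertex _ (T.anc v n) := by
  rw [ray, Nat.ceil_natCast, T.edgePoint_of_lev_le]
  rw [lev_anc]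
  exact_mod_cast min_le_left _ _

theorem ray_lev (v : V) : T.ray v (T.lev v) = MetricGraph.vertex _ v := by
  rw [ray_natCast, T.anc_of_le le_rfl]

theorem exists_edgePoint_of_onEdge {p : T.Realisation} {a b : V} (hp : p.OnEdge a b)
    (hab : T.par a = b) :
    p.coord a ∈ Icc (0 : ℝ) 1 ∧ p = T.edgePoint a (p.coord a + T.lev a - 1) := by
  obtain ⟨h, s, s', hs, hs', hss, hps⟩ := hp
  subst hab
  have h0 := T.lev_ne_zero_of_adj h
  have hc : p.coord a = s := by
    rw [← hps]
    simp [vertexCoord_self, vertexCoord_of_ne (T.par_ne h0)]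
  rw [hc]
  refine ⟨⟨hs, by linarith⟩, ?_⟩
  ext1
  rw [← hps]
  simp only [edgePoint]
  rw [T.edgeParam_eq (by linarith) (by linarith)]
  congr 2 <;> linarith

theorem ray_eq_edgePoint_self {u : V} {s : ℝ} (h1 : (T.lev u : ℝ) - 1 ≤ s) (h2 : s ≤ T.lev u) :
    T.ray u s = T.edgePoint u s := by
  rw [T.ray_eq_edgePoint u (n := T.lev u) (by linarith) h2, T.anc_of_le le_rfl]

/-- The upper endpoint of the edge serves as `u`: each piece of a path moves along a single geodesic
from the root, and its length is the change of height. -/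
theorem exists_ray_of_onEdge {p q : T.Realisation} {a b : V} (hp : p.OnEdge a b)
    (hq : q.OnEdge a b) :
    ∃ u s t, s ∈ Icc (0 : ℝ) (T.lev u) ∧ t ∈ Icc (0 : ℝ) (T.lev u) ∧ p = T.ray u s ∧
      q = T.ray u t ∧ |p.coord a - q.coord a| = |s - t| := by
  have key : ∀ {a b : V}, p.OnEdge a b → q.OnEdge a b → T.par a = b →
      ∃ u s t, s ∈ Icc (0 : ℝ) (T.lev u) ∧ t ∈ Icc (0 : ℝ) (T.lev u) ∧ p = T.ray u s ∧
      q = T.ray u t ∧ |p.coord a - q.coord a| = |s - t| := by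
    intro a b hp hq hab
    have h0 : 1 ≤ T.lev a := by
      have := T.lev_ne_zero_of_adj (hab ▸ hp.1)
      omega
    have h0' : (1 : ℝ) ≤ T.lev a := by exact_mod_cast h0
    obtain ⟨⟨hp0, hp1⟩, hp2⟩ := T.exists_edgePoint_of_onEdge hp hab
    obtain ⟨⟨hq0, hq1⟩, hq2⟩ := T.exists_edgePoint_of_onEdge hq hab
    refine ⟨a, p.coord a + T.lev a - 1, q.coord a + T.lev a - 1, ⟨by linarith, by linarith⟩,
      ⟨by linarith, by linarith⟩, ?_, ?_, ?_⟩
    · rwa [T.ray_eq_edgePoint_self (by linarith) (by linarith)]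
    · rwa [T.ray_eq_edgePoint_self (by linarith) (by linarith)]
    · congr 1; ring
  rcases hp.1.2 with h | h
  · exact key hp hq h
  · have hsymm : ∀ {p : T.Realisation}, p.OnEdge a b → p.OnEdge b a := fun hp =>
      ⟨hp.1.symm, by rw [segment_symm]; exact hp.2⟩
    obtain ⟨u, s, t, hs, ht, hps, hqt, he⟩ := key (hsymm hp) (hsymm hq) h
    refine ⟨u, s, t, hs, ht, hps, hqt, ?_⟩
    -- The two barycentric coordinates on an edge change by the same amount, so exchanging its
    -- endpoints keeps the length.
    rw [← he]
    exact le_antisymm (MetricGraph.abs_coord_sub_le_of_onEdge (hsymm hp) (hsymm hq) a)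
      (MetricGraph.abs_coord_sub_le_of_onEdge hp hq b)

theorem exists_eq_ray (p : T.Realisation) : ∃ v s, s ∈ Icc (0 : ℝ) (T.lev v) ∧ p = T.ray v s := by
  rcases p.mem_simplex with ⟨a, ha⟩ | ⟨a, b, hab, hp⟩
  · refine ⟨a, T.lev a, ⟨Nat.cast_nonneg _, le_rfl⟩, ?_⟩
    rw [T.ray_lev]
    exact MetricGraph.ext ha
  · obtain ⟨u, s, t, hs, -, h, -⟩ := T.exists_ray_of_onEdge ⟨hab, hp⟩ ⟨hab, hp⟩
    exact ⟨u, s, hs, h⟩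

/-- The condition on the level puts the point on the edge below `u` without its lower endpoint,
which is what makes `u` unique. -/
theorem edgePoint_coord_pos {u : V} {s : ℝ} (h : T.lev u = ⌈s⌉₊) :
    0 < (T.edgePoint u s).coord u := by
  by_cases h0 : T.lev u = 0
  · rw [T.edgePoint_of_lev_eq_zero h0]
    simp [MetricGraph.vertex, vertexCoord_self]
  · have hs : 0 < s := Nat.ceil_pos.1 (by omega)
    rw [T.edgePoint_coord_self h0, edgeParam, h]
    have := Nat.ceil_lt_add_one hs.le
    exact lt_max_of_lt_right (lt_min one_pos (by linarith))

theorem eq_or_eq_par_of_edgePoint_coord_pos {u w : V} {s : ℝ}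
    (h : 0 < (T.edgePoint u s).coord w) : w = u ∨ w = T.par u := by
  by_contra! hw
  simp [edgePoint, vertexCoord_of_ne hw.1, vertexCoord_of_ne hw.2] at h

theorem edgePoint_injective {u w : V} {s t : ℝ} (hs : 0 ≤ s) (ht : 0 ≤ t) (hu : T.lev u = ⌈s⌉₊)
    (hw : T.lev w = ⌈t⌉₊) (h : T.edgePoint u s = T.edgePoint w t) : u = w ∧ s = t := by
  have h1 := T.eq_or_eq_par_of_edgePoint_coord_pos (h ▸ T.edgePoint_coord_pos hu)
  have h2 := T.eq_or_eq_par_of_edgePoint_coord_pos (h ▸ T.edgePoint_coord_pos hw)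
  -- Each of `u`, `w` supports the common point, so it is the other one or its parent. If each is
  -- the parent of the other, both have level `0` and are the root.
  have huw : u = w := by
    rcases h1 with h1 | h1
    · exact h1
    rcases h2 with h2 | h2
    · exact h2.symm
    have h3 := congrArg T.lev h1
    have h4 := congrArg T.lev h2
    rw [T.lev_par] at h3 h4
    rw [T.eq_root u (by omega), T.eq_root w (by omega)]
  subst huw
  refine ⟨rfl, ?_⟩
  by_cases h0 : T.lev u = 0
  · rw [h0] at hu hw
    have := Nat.ceil_eq_zero.1 hu.symm
    have := Nat.ceil_eq_zero.1 hw.symm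
    linarith
  · have h5 := congrFun (congrArg MetricGraph.coord h) u
    have a1 := Nat.le_ceil s
    have a2 := Nat.ceil_lt_add_one hs
    have a3 := Nat.le_ceil t
    have a4 := Nat.ceil_lt_add_one ht
    rw [← hu] at a1 a2
    rw [← hw] at a3 a4
    rw [T.edgePoint_coord_self h0, T.edgePoint_coord_self h0, T.edgeParam_eq (by linarith) a1,
      T.edgeParam_eq (by linarith) a3] at h5
    linarith

theorem lev_anc_ceil {v : V} {s : ℝ} (h : s ≤ T.lev v) : T.lev (T.anc v ⌈s⌉₊) = ⌈s⌉₊ := by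
  rw [lev_anc, min_eq_left (Nat.ceil_le.2 h)]

theorem ray_injective {v w : V} {s t : ℝ} (hs : s ∈ Icc (0 : ℝ) (T.lev v))
    (ht : t ∈ Icc (0 : ℝ) (T.lev w)) (h : T.ray v s = T.ray w t) :
    s = t ∧ T.anc v ⌈s⌉₊ = T.anc w ⌈s⌉₊ := by
  obtain ⟨h1, rfl⟩ := T.edgePoint_injective hs.1 ht.1 (T.lev_anc_ceil hs.2) (T.lev_anc_ceil ht.2) h
  exact ⟨rfl, h1⟩

theorem ray_eq_of_le {v w : V} {s t : ℝ} (hs : s ∈ Icc (0 : ℝ) (T.lev v))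
    (hs' : s ∈ Icc (0 : ℝ) (T.lev w)) (h : T.ray v s = T.ray w s) (hts : t ≤ s) :
    T.ray v t = T.ray w t := by
  have := (T.ray_injective hs hs' h).2
  have hc := Nat.ceil_mono hts
  rw [ray, ray, ← T.anc_anc v hc, this, T.anc_anc w hc]

/-- A vertex above the point `p`. -/
noncomputable def top (p : T.Realisation) : V := (T.exists_eq_ray p).choose

/-- The height of the point `p`. -/
noncomputable def ht (p : T.Realisation) : ℝ := (T.exists_eq_ray p).choose_spec.choose

theorem ht_mem (p : T.Realisation) : T.ht p ∈ Icc (0 : ℝ) (T.lev (T.top p)) :=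
  (T.exists_eq_ray p).choose_spec.choose_spec.1

theorem ht_nonneg (p : T.Realisation) : 0 ≤ T.ht p := (T.ht_mem p).1

theorem ray_top_ht (p : T.Realisation) : T.ray (T.top p) (T.ht p) = p :=
  (T.exists_eq_ray p).choose_spec.choose_spec.2.symm

/-- By uniqueness, the arbitrary choices in `top` and `ht` do not affect the height. -/
theorem ht_ray {v : V} {s : ℝ} (hs : s ∈ Icc (0 : ℝ) (T.lev v)) : T.ht (T.ray v s) = s :=
  (T.ray_injective (T.ht_mem _) hs (T.ray_top_ht _)).1

/-- The point of height `s` on the geodesic from the root to `p` (or `p` if its height is at most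
`s`). -/
noncomputable def below (p : T.Realisation) (s : ℝ) : T.Realisation :=
  T.ray (T.top p) (min s (T.ht p))

theorem below_of_ht_le {p : T.Realisation} {s : ℝ} (h : T.ht p ≤ s) : T.below p s = p := by
  rw [below, min_eq_right h, ray_top_ht]

theorem below_ray {v : V} {s t : ℝ} (hs : s ∈ Icc (0 : ℝ) (T.lev v)) (hts : t ≤ s) :
    T.below (T.ray v s) t = T.ray v t := by
  have h := T.ht_ray hs
  rw [below, h, min_eq_left hts]
  have h1 := T.ht_mem (T.ray v s)
  rw [h] at h1
  refine T.ray_eq_of_le h1 hs ?_ hts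
  have h2 := T.ray_top_ht (T.ray v s)
  rwa [h] at h2

theorem below_mem {p : T.Realisation} {s : ℝ} (hs : 0 ≤ s) :
    min s (T.ht p) ∈ Icc (0 : ℝ) (T.lev (T.top p)) :=
  ⟨le_min hs (T.ht_nonneg p), (min_le_right _ _).trans (T.ht_mem p).2⟩

theorem ht_below {p : T.Realisation} {s : ℝ} (hs : 0 ≤ s) (hsp : s ≤ T.ht p) :
    T.ht (T.below p s) = s := by
  rw [below, T.ht_ray (T.below_mem hs), min_eq_left hsp]

theorem below_below {p : T.Realisation} {s t : ℝ} (hs : 0 ≤ s) (hts : t ≤ s) :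
    T.below (T.below p s) t = T.below p t := by
  rcases le_total t (T.ht p) with h | h
  · rw [below.eq_1 T p s, T.below_ray (T.below_mem hs) (le_min hts h), below, min_eq_left h]
  · rw [T.below_of_ht_le (h.trans hts)]

theorem below_natCast {p : T.Realisation} {n : ℕ} (h : n ≤ T.ht p) :
    T.below p n = MetricGraph.vertex _ (T.anc (T.top p) n) := by
  rw [below, min_eq_left h, ray_natCast]

/-! ### Lengths of paths and distances -/

theorem hasPath_ray {v : V} {s t : ℝ} (hs : 0 ≤ s) (hst : s ≤ t) (ht : t ≤ T.lev v) :
    MetricGraph.HasPath (T.ray v t) (T.ray v s) (t - s) := by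
  have step : ∀ {s t : ℝ} {n : ℕ}, (n : ℝ) ≤ s → s ≤ t → t ≤ n + 1 → t ≤ T.lev v →
      MetricGraph.HasPath (T.ray v t) (T.ray v s) (t - s) := by
    intro s t n hns hst htn ht
    rcases hst.eq_or_lt with rfl | hlt
    · rw [sub_self]; exact MetricGraph.HasPath.nil _
    have hnv : n + 1 ≤ T.lev v := by
      have : (n : ℝ) < T.lev v := by linarith
      exact_mod_cast this
    have hl : T.lev (T.anc v (n + 1)) = n + 1 := by rw [lev_anc, min_eq_left hnv]
    have hl0 : T.lev (T.anc v (n + 1)) ≠ 0 := by omega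
    have hl' : (T.lev (T.anc v (n + 1)) : ℝ) = n + 1 := by rw [hl]; push_cast; rfl
    rw [T.ray_eq_edgePoint v (n := n + 1) (s := s) (by push_cast; linarith)
      (by push_cast; linarith), T.ray_eq_edgePoint v (n := n + 1) (s := t) (by push_cast; linarith)
      (by push_cast; linarith)]
    have h := MetricGraph.HasPath.cons _ _ (T.onEdge_edgePoint hl0 t) (T.onEdge_edgePoint hl0 s)
      (MetricGraph.HasPath.nil _)
    rw [T.edgePoint_coord_self hl0, T.edgePoint_coord_self hl0,
      T.edgeParam_eq (by linarith) (by linarith), T.edgeParam_eq (by linarith) (by linarith),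
      abs_of_nonneg (by linarith)] at h
    convert h using 1
    ring
  -- Induction on an integer bound for the upper height, cutting off the part above the last
  -- integer.
  have main : ∀ n : ℕ, ∀ t : ℝ, s ≤ t → t ≤ T.lev v → t ≤ n →
      MetricGraph.HasPath (T.ray v t) (T.ray v s) (t - s) := by
    intro n
    induction n with
    | zero =>
      intro t hst ht htn
      exact step (n := 0) (by simpa using hs) hst (by push_cast at htn ⊢; linarith) ht
    | succ n ih =>
      intro t hst ht htn
      push_cast at htn
      rcases le_total (n : ℝ) s with h | h
      · exact step h hst htn ht
      rcases le_total (n : ℝ) t with h' | h'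
      · have := (step le_rfl h' htn ht).trans (ih n h (h'.trans ht) le_rfl)
        rwa [sub_add_sub_cancel] at this
      · exact ih t hst ht h'
  obtain ⟨n, hn⟩ := exists_nat_ge t
  exact main n t hst ht hn

theorem hasPath_below {p : T.Realisation} {s t : ℝ} (hs : 0 ≤ s) (hst : s ≤ t) (ht : t ≤ T.ht p) :
    MetricGraph.HasPath (T.below p t) (T.below p s) (t - s) := by
  rw [below, below, min_eq_left ht, min_eq_left (hst.trans ht)]
  exact T.hasPath_ray hs hst (ht.trans (T.ht_mem p).2)

/-- A path from `p` to `q` descends at least to a common ancestor of `p` and `q`. -/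
theorem exists_below_eq_of_hasPath {p q : T.Realisation} {L : ℝ} (h : MetricGraph.HasPath p q L) :
    ∃ m, 0 ≤ m ∧ m ≤ T.ht p ∧ m ≤ T.ht q ∧ T.below p m = T.below q m ∧
      T.ht p + T.ht q - L ≤ 2 * m := by
  induction h with
  | nil p => exact ⟨T.ht p, T.ht_nonneg p, le_rfl, le_rfl, rfl, by linarith⟩
  | @cons p r q L a b hp hr h ih =>
    obtain ⟨m, hm0, hmr, hmq, hm, hle⟩ := ih
    obtain ⟨u, s, t, hs, ht, rfl, rfl, he⟩ := T.exists_ray_of_onEdge hp hr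
    rw [he]
    rw [T.ht_ray ht] at hmr hle
    rw [T.ht_ray hs]
    rw [T.below_ray ht hmr] at hm
    -- The path first moves from height `s` to height `t`. The old ancestor height `m` still works
    -- unless the start lies below it; then the start itself is the common ancestor.
    rcases le_total s t with hst | hst
    · rw [abs_of_nonpos (by linarith)]
      rcases le_total m s with hms | hms
      · exact ⟨m, hm0, hms, hmq, by rw [T.below_ray hs hms, hm], by linarith⟩
      · refine ⟨s, hs.1, le_rfl, hms.trans hmq, ?_, by linarith⟩
        rw [T.below_ray hs le_rfl, ← T.below_below hm0 hms, ← hm,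
          T.below_ray ⟨hm0, hmr.trans ht.2⟩ hms]
    · rw [abs_of_nonneg (by linarith)]
      exact ⟨m, hm0, hmr.trans hst, hmq, by rw [T.below_ray hs (hmr.trans hst), hm], by linarith⟩

theorem below_eq_of_le {p q : T.Realisation} {m s : ℝ} (hm : 0 ≤ m) (h : T.below p m = T.below q m)
    (hs : s ≤ m) : T.below p s = T.below q s := by
  rw [← T.below_below hm hs, h, T.below_below hm hs]

theorem exists_hasPath_lt {p q : T.Realisation} {ε : ℝ} (h : dist p q < ε) :
    ∃ L < ε, MetricGraph.HasPath p q L := by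
  obtain ⟨L, hL, hlt⟩ := exists_lt_of_csInf_lt (MetricGraph.exists_hasPath p q) h
  exact ⟨L, hlt, hL⟩

theorem le_dist {p q : T.Realisation} {K : ℝ}
    (h : ∀ m, 0 ≤ m → m ≤ T.ht p → m ≤ T.ht q → T.below p m = T.below q m →
      2 * m ≤ T.ht p + T.ht q - K) : K ≤ dist p q := by
  refine MetricGraph.le_pathDist fun L hL => ?_
  obtain ⟨m, h0, h1, h2, h3, h4⟩ := T.exists_below_eq_of_hasPath hL
  linarith [h m h0 h1 h2 h3]

theorem abs_ht_sub_le (p q : T.Realisation) : |T.ht p - T.ht q| ≤ dist p q := by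
  refine T.le_dist fun m _ h1 h2 _ => ?_
  rcases abs_cases (T.ht p - T.ht q) with h | h <;> linarith

theorem continuous_ht : Continuous T.ht := by
  refine LipschitzWith.continuous (K := 1) (LipschitzWith.of_dist_le_mul fun p q => ?_)
  rw [NNReal.coe_one, one_mul, Real.dist_eq]
  exact T.abs_ht_sub_le p q

theorem dist_below {p : T.Realisation} {s t : ℝ} (hs : s ∈ Icc 0 (T.ht p))
    (ht : t ∈ Icc 0 (T.ht p)) :
    dist (T.below p s) (T.below p t) = |s - t| := by
  refine le_antisymm ?_ ?_
  · rcases le_total s t with h | h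
    · rw [abs_sub_comm, abs_of_nonneg (by linarith), dist_comm]
      exact MetricGraph.pathDist_le (T.hasPath_below hs.1 h ht.2)
    · rw [abs_of_nonneg (by linarith)]
      exact MetricGraph.pathDist_le (T.hasPath_below ht.1 h hs.2)
  · have := T.abs_ht_sub_le (T.below p s) (T.below p t)
    rwa [T.ht_below hs.1 hs.2, T.ht_below ht.1 ht.2] at this

theorem continuousOn_below (p : T.Realisation) : ContinuousOn (T.below p) (Icc 0 (T.ht p)) := by
  refine LipschitzOnWith.continuousOn (K := 1) (LipschitzOnWith.of_dist_le_mul fun s hs t ht => ?_)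
  rw [T.dist_below hs ht, NNReal.coe_one, one_mul, Real.dist_eq]

/-- A path this short cannot descend to height `s`. Hence truncation to height `s` is locally
constant on the points above `s`, which drives both separation arguments below. -/
theorem below_eq_of_dist_lt {p q : T.Realisation} {s : ℝ} (h : dist p q < T.ht p - s) :
    T.below p s = T.below q s := by
  obtain ⟨L, hL, hP⟩ := T.exists_hasPath_lt h
  obtain ⟨m, h0, h1, h2, h3, h4⟩ := T.exists_below_eq_of_hasPath hP
  exact T.below_eq_of_le h0 h3 (by linarith)

theorem dist_below_below_le (p q : T.Realisation) {s : ℝ} (hs : 0 ≤ s) :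
    dist (T.below p s) (T.below q s) ≤ dist p q := by
  refine MetricGraph.le_pathDist fun L hL => ?_
  obtain ⟨m, h0, h1, h2, h3, h4⟩ := T.exists_below_eq_of_hasPath hL
  rcases le_total s m with h | h
  · rw [T.below_eq_of_le h0 h3 h, dist_self]
    exact hL.nonneg
  -- Above the common ancestor, the truncations are joined through it, by a path no longer than the
  -- original one.
  · have key : ∀ r : T.Realisation, m ≤ T.ht r →
        dist (T.below r s) (T.below r m) ≤ T.ht r - m := by
      intro r hr
      have : T.below r s = T.below r (min s (T.ht r)) := by
        rw [below, below, min_assoc, min_self]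
      rw [this, T.dist_below ⟨le_min hs (h0.trans hr), min_le_right _ _⟩ ⟨h0, hr⟩,
        abs_of_nonneg (sub_nonneg.2 (le_min h hr))]
      linarith [min_le_right s (T.ht r)]
    have hp := key p h1
    have hq := key q h2
    rw [← h3, dist_comm] at hq
    linarith [dist_triangle (T.below p s) (T.below p m) (T.below q s)]

theorem continuous_below {s : ℝ} (hs : 0 ≤ s) : Continuous fun p => T.below p s := by
  refine LipschitzWith.continuous (K := 1) (LipschitzWith.of_dist_le_mul fun p q => ?_)
  rw [NNReal.coe_one, one_mul]
  exact T.dist_below_below_le p q hs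

/-- The root as a point of the realisation. -/
noncomputable abbrev rootPoint : T.Realisation := MetricGraph.vertex _ T.root

theorem below_zero (p : T.Realisation) : T.below p 0 = T.rootPoint := by
  have := T.below_natCast (p := p) (n := 0) (by exact_mod_cast T.ht_nonneg p)
  rw [Nat.cast_zero] at this
  rw [this, T.eq_root (T.anc (T.top p) 0) (by rw [lev_anc]; exact Nat.zero_min _)]

theorem dist_rootPoint (p : T.Realisation) : dist p T.rootPoint = T.ht p := by
  have h := T.dist_below (p := p) ⟨T.ht_nonneg p, le_rfl⟩ ⟨le_rfl, T.ht_nonneg p⟩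
  rwa [T.below_zero, T.below_of_ht_le le_rfl, sub_zero, abs_of_nonneg (T.ht_nonneg p)] at h

/-! ### Common ancestors and the `ℝ`-tree property -/

/-- The highest common ancestor. -/
theorem exists_meet (p q : T.Realisation) : ∃ m, 0 ≤ m ∧ m ≤ T.ht p ∧ m ≤ T.ht q ∧
    T.below p m = T.below q m ∧
    ∀ s, 0 ≤ s → s ≤ T.ht p → s ≤ T.ht q → T.below p s = T.below q s → s ≤ m := by
  set I := Icc 0 (min (T.ht p) (T.ht q)) with hI
  -- The heights at which the truncations agree form a compact set, nonempty because both truncate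
  -- to the root at height `0`.
  have hc : IsCompact {s ∈ I | T.below p s = T.below q s} := by
    refine isCompact_Icc.of_isClosed_subset ?_ (sep_subset _ _)
    have hp : ContinuousOn (T.below p) I :=
      (T.continuousOn_below p).mono (Icc_subset_Icc_right (min_le_left _ _))
    have hq : ContinuousOn (T.below q) I :=
      (T.continuousOn_below q).mono (Icc_subset_Icc_right (min_le_right _ _))
    exact (hp.prodMk hq).preimage_isClosed_of_isClosed isClosed_Icc isClosed_diagonal
  obtain ⟨m, ⟨hm, hm'⟩, hmax⟩ := hc.exists_isMaxOn (f := id)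
    ⟨0, ⟨le_rfl, le_min (T.ht_nonneg p) (T.ht_nonneg q)⟩, by simp only [T.below_zero]⟩
    continuousOn_id
  exact ⟨m, hm.1, hm.2.trans (min_le_left _ _), hm.2.trans (min_le_right _ _), hm',
    fun s h0 h1 h2 h3 => hmax ⟨⟨h0, le_min h1 h2⟩, h3⟩⟩

/-- A connected set that contains `p` and `q` contains the points strictly between `p` and the
highest common ancestor. -/
theorem below_mem_of_isPreconnected {p q : T.Realisation} {S : Set T.Realisation}
    (hS : IsPreconnected S) (hp : p ∈ S) (hq : q ∈ S) {s : ℝ} (h0 : 0 ≤ s) (hsp : s < T.ht p)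
    (hne : s ≤ T.ht q → T.below p s ≠ T.below q s) : T.below p s ∈ S := by
  by_contra hz
  set z := T.below p s with hzdef
  -- The points strictly above `z` and those not at or above `z` form two disjoint open sets that
  -- miss only `z`. If `z` is not in `S`, they separate `p` from `q`.
  have hU : IsOpen {w | s < T.ht w ∧ T.below w s = z} := by
    rw [Metric.isOpen_iff]
    rintro w ⟨hw, hwz⟩
    refine ⟨T.ht w - s, by linarith, fun w' hw' => ?_⟩
    rw [mem_ball, dist_comm] at hw'
    refine ⟨?_, by rw [← T.below_eq_of_dist_lt hw', hwz]⟩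
    linarith [le_abs_self (T.ht w - T.ht w'), T.abs_ht_sub_le w w']
  have hW : IsOpen {w | ¬ (s ≤ T.ht w ∧ T.below w s = z)} := by
    have : IsClosed {w | s ≤ T.ht w ∧ T.below w s = z} :=
      (isClosed_le continuous_const T.continuous_ht).inter
        (isClosed_eq (T.continuous_below h0) continuous_const)
    exact this.isOpen_compl
  have hcov : S ⊆ {w | s < T.ht w ∧ T.below w s = z} ∪ {w | ¬ (s ≤ T.ht w ∧ T.below w s = z)} := by
    intro w hw
    by_cases h : s ≤ T.ht w ∧ T.below w s = z
    · left
      refine ⟨lt_of_le_of_ne h.1 fun he => hz ?_, h.2⟩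
      rw [← h.2, T.below_of_ht_le he.ge]
      exact hw
    · exact Or.inr h
  obtain ⟨w, -, ⟨h1, h2⟩, h3⟩ := hS _ _ hU hW hcov ⟨p, hp, hsp, rfl⟩
    ⟨q, hq, fun h => hne h.1 h.2.symm⟩
  exact h3 ⟨h1.le, h2⟩

/-- Heights strictly between the meet and `p` are covered by the preceding lemma; closedness of `S`
adds the two end heights. -/
theorem below_mem_of_isPreconnected_of_isClosed {p q : T.Realisation} {S : Set T.Realisation}
    (hS : IsPreconnected S) (hc : IsClosed S) (hp : p ∈ S) (hq : q ∈ S) {m : ℝ} (hm : 0 ≤ m)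
    (hmax : ∀ s, 0 ≤ s → s ≤ T.ht p → s ≤ T.ht q → T.below p s = T.below q s → s ≤ m)
    {s : ℝ} (hs : s ∈ Icc m (T.ht p)) : T.below p s ∈ S := by
  rcases (hs.1.trans hs.2).eq_or_lt with h | h
  · rw [T.below_of_ht_le (by linarith [hs.1])]
    exact hp
  rw [← closure_Ioo h.ne] at hs
  have hcont : ContinuousOn (T.below p) (closure (Ioo m (T.ht p))) := by
    rw [closure_Ioo h.ne]
    exact (T.continuousOn_below p).mono (Icc_subset_Icc_left hm)
  have h1 := hcont.image_closure (mem_image_of_mem _ hs)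
  refine closure_minimal ?_ hc h1
  rintro _ ⟨t, ht, rfl⟩
  refine T.below_mem_of_isPreconnected hS hp hq (hm.trans ht.1.le) ht.2 fun h1 h2 => ?_
  exact absurd (hmax t (hm.trans ht.1.le) ht.2.le h1 h2) (not_le.2 ht.1)

theorem dist_below_of_meet {p q : T.Realisation} {m a b : ℝ} (hm : 0 ≤ m)
    (h : T.below p m = T.below q m)
    (hmax : ∀ s, 0 ≤ s → s ≤ T.ht p → s ≤ T.ht q → T.below p s = T.below q s → s ≤ m)
    (ha : a ∈ Icc m (T.ht p)) (hb : b ∈ Icc m (T.ht q)) :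
    dist (T.below p a) (T.below q b) = a + b - 2 * m := by
  refine le_antisymm ?_ (T.le_dist fun s h0 h1 h2 h3 => ?_)
  · have h1 := T.dist_below (p := p) ⟨hm.trans ha.1, ha.2⟩ ⟨hm, ha.1.trans ha.2⟩
    have h2 := T.dist_below (p := q) ⟨hm, hb.1.trans hb.2⟩ ⟨hm.trans hb.1, hb.2⟩
    rw [abs_of_nonneg (by linarith [ha.1])] at h1
    rw [← h, abs_of_nonpos (by linarith [hb.1])] at h2
    linarith [dist_triangle (T.below p a) (T.below p m) (T.below q b)]
  · rw [T.ht_below (hm.trans ha.1) ha.2] at *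
    rw [T.ht_below (hm.trans hb.1) hb.2] at *
    rw [T.below_below (hm.trans ha.1) h1, T.below_below (hm.trans hb.1) h2] at h3
    linarith [hmax s h0 (h1.trans ha.2) (h2.trans hb.2) h3]

/-- The geodesic descends from `p` to the highest common ancestor and then ascends to `q`. An
embedded arc between these points contains it because the arc is connected and closed, and has no
further points because a connected subset of an interval containing both ends is the whole interval.
-/
theorem isRTree : IsRTree T.Realisation := by
  intro p q
  obtain ⟨m, hm0, hmp, hmq, hm, hmax⟩ := T.exists_meet p q
  have hmax' : ∀ s, 0 ≤ s → s ≤ T.ht q → s ≤ T.ht p → T.below q s = T.below p s → s ≤ m :=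
    fun s h0 h1 h2 h3 => hmax s h0 h2 h1 h3.symm
  have hd : dist p q = T.ht p + T.ht q - 2 * m := by
    have := T.dist_below_of_meet hm0 hm hmax ⟨hmp, le_rfl⟩ ⟨hmq, le_rfl⟩
    rwa [T.below_of_ht_le le_rfl, T.below_of_ht_le le_rfl] at this
  set α : ℝ → T.Realisation := fun t => if t ≤ T.ht p - m then T.below p (T.ht p - t)
    else T.below q (t - T.ht p + 2 * m) with hα
  have hα1 : ∀ t, t ≤ T.ht p - m → α t = T.below p (T.ht p - t) := fun t ht => if_pos ht
  have hα2 : ∀ t, T.ht p - m ≤ t → α t = T.below q (t - T.ht p + 2 * m) := by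
    intro t ht
    rcases ht.eq_or_lt with h | h
    · rw [hα1 t h.ge, ← h, show T.ht p - (T.ht p - m) = m by ring,
        show T.ht p - m - T.ht p + 2 * m = m by ring, hm]
    · exact if_neg (not_le.2 h)
  have hgeo : ∀ s ∈ Icc (0 : ℝ) (dist p q), ∀ t ∈ Icc (0 : ℝ) (dist p q), s ≤ t →
      dist (α s) (α t) = |s - t| := by
    intro s hs t ht hst
    rw [hd] at hs ht
    rw [abs_of_nonpos (by linarith)]
    rcases le_total t (T.ht p - m) with h | h
    · rw [hα1 s (by linarith), hα1 t h, T.dist_below ⟨by linarith, by linarith [hs.1]⟩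
        ⟨by linarith, by linarith [ht.1]⟩, abs_of_nonneg (by linarith)]
      ring
    rcases le_total s (T.ht p - m) with h' | h'
    · rw [hα1 s h', hα2 t h, T.dist_below_of_meet hm0 hm hmax ⟨by linarith, by linarith [hs.1]⟩
        ⟨by linarith, by linarith [ht.2]⟩]
      ring
    · rw [hα2 s h', hα2 t h, T.dist_below ⟨by linarith, by linarith [hs.2]⟩
        ⟨by linarith, by linarith [ht.2]⟩, abs_of_nonpos (by linarith)]
      ring
  have hgeo' : ∀ s ∈ Icc (0 : ℝ) (dist p q), ∀ t ∈ Icc (0 : ℝ) (dist p q),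
      dist (α s) (α t) = |s - t| := by
    intro s hs t ht
    rcases le_total s t with h | h
    · exact hgeo s hs t ht h
    · rw [dist_comm, abs_sub_comm]
      exact hgeo t ht s hs h
  have hα0 : α 0 = p := by rw [hα1 0 (by linarith), T.below_of_ht_le (by linarith)]
  have hαd : α (dist p q) = q := by
    rw [hα2 _ (by rw [hd]; linarith), T.below_of_ht_le (by rw [hd]; linarith)]
  refine ⟨α, ⟨hα0, hαd, hgeo'⟩, fun r β hr hβ0 hβr hβ => ?_⟩
  have hαc : ContinuousOn α (Icc 0 (dist p q)) := by
    refine LipschitzOnWith.continuousOn (K := 1)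
      (LipschitzOnWith.of_dist_le_mul fun s hs t ht => ?_)
    rw [hgeo' s hs t ht, NNReal.coe_one, one_mul, Real.dist_eq]
  have hβc : ContinuousOn β (Icc 0 r) := continuousOn_iff_continuous_domRestrict.2 hβ.continuous
  have hpre : IsPreconnected (β '' Icc 0 r) := isPreconnected_Icc.image _ hβc
  have hcl : IsClosed (β '' Icc 0 r) := (isCompact_Icc.image_of_continuousOn hβc).isClosed
  have hpS : p ∈ β '' Icc 0 r := ⟨0, ⟨le_rfl, hr⟩, hβ0⟩
  have hqS : q ∈ β '' Icc 0 r := ⟨r, ⟨hr, le_rfl⟩, hβr⟩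
  have hsub : α '' Icc 0 (dist p q) ⊆ β '' Icc 0 r := by
    rintro _ ⟨t, ht, rfl⟩
    rw [hd] at ht
    rcases le_total t (T.ht p - m) with h | h
    · rw [hα1 t h]
      exact T.below_mem_of_isPreconnected_of_isClosed hpre hcl hpS hqS hm0 hmax
        ⟨by linarith, by linarith [ht.1]⟩
    · rw [hα2 t h]
      exact T.below_mem_of_isPreconnected_of_isClosed hpre hcl hqS hpS hm0 hmax'
        ⟨by linarith, by linarith [ht.2]⟩
  refine Subset.antisymm ?_ hsub
  have hαp : IsPreconnected (α '' Icc 0 (dist p q)) := isPreconnected_Icc.image _ hαc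
  set f := (Icc (0 : ℝ) r).domRestrict β with hf
  have himg : f '' (f ⁻¹' (α '' Icc 0 (dist p q))) = α '' Icc 0 (dist p q) := by
    rw [image_preimage_eq_iff]
    intro y hy
    obtain ⟨t, ht, rfl⟩ := hsub hy
    exact ⟨⟨t, ht⟩, rfl⟩
  -- The embedding transfers connectedness of the geodesic back to its set of parameters.
  rw [← himg, hβ.isInducing.isPreconnected_image] at hαp
  have h2 := (hαp.image Subtype.val continuous_subtype_val.continuousOn).Icc_subset
    (a := 0) (b := r)
    ⟨⟨0, ⟨le_rfl, hr⟩⟩, ⟨0, ⟨le_rfl, dist_nonneg⟩, hα0.trans hβ0.symm⟩, rfl⟩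
    ⟨⟨r, ⟨hr, le_rfl⟩⟩, ⟨_, ⟨dist_nonneg, le_rfl⟩, hαd.trans hβr.symm⟩, rfl⟩
  rintro _ ⟨t, ht, rfl⟩
  obtain ⟨t', ht', rfl⟩ := h2 ht
  exact ht'

end LeveledTree

/-! ### Comparing spaces of ends -/

theorem InSamePathComponent.joinedIn {Y : Type u} [MetricSpace Y] {y₀ : Y} {r : ℝ} {A B : Set Y}
    (h : InSamePathComponent y₀ r A B) {a b : Y} (ha : a ∈ A) (hb : b ∈ B) :
    JoinedIn (closedBall y₀ r)ᶜ a b := by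
  obtain ⟨z, -, hA, hB⟩ := h
  exact (hA ha : JoinedIn _ z a).symm.trans (hB hb)

theorem InSamePathComponent.mono_compl {Y : Type u} [MetricSpace Y] {y₀ y₁ : Y} {r s : ℝ}
    {A B : Set Y} (h : InSamePathComponent y₀ r A B) (hr : closedBall y₁ s ⊆ closedBall y₀ r) :
    InSamePathComponent y₁ s A B := by
  obtain ⟨z, hz, hA, hB⟩ := h
  have := compl_subset_compl.2 hr
  exact ⟨z, this hz, hA.trans (pathComponentIn_mono this), hB.trans (pathComponentIn_mono this)⟩

/-- A bijection of spaces of ends that preserves convergence in both directions is a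
homeomorphism. -/
def SpaceOfEnds.homeomorphOfConvergesTo {X : Type u} [MetricSpace X] {x₀ : X} {Y : Type v}
    [MetricSpace Y] {y₀ : Y} (f : SpaceOfEnds X x₀ ≃ SpaceOfEnds Y y₀)
    (hf : ∀ e e', ConvergesTo e e' → ConvergesTo (f ∘ e) (f e'))
    (hf' : ∀ e e', ConvergesTo e e' → ConvergesTo (f.symm ∘ e) (f.symm e')) :
    SpaceOfEnds X x₀ ≃ₜ SpaceOfEnds Y y₀ where
  toEquiv := f
  continuous_toFun := continuous_iff_isClosed.2 fun C hC =>
    (isClosed_iff _).2 fun e e' he h => (isClosed_iff C).1 hC _ _ he (hf e e' h)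
  continuous_invFun := continuous_iff_isClosed.2 fun C hC =>
    (isClosed_iff _).2 fun e e' he h => (isClosed_iff C).1 hC _ _ he (hf' e e' h)

/-! ### Change of the base point -/

section BasePoint

variable {Y : Type u} [MetricSpace Y]

theorem closedBall_subset_closedBall_add_dist (y₀ y₁ : Y) (r : ℝ) :
    closedBall y₁ r ⊆ closedBall y₀ (r + dist y₁ y₀) :=
  closedBall_subset_closedBall' le_rfl

/-- A proper ray, with respect to another base point. -/
def ProperRay.changeBase {y₀ : Y} (y₁ : Y) (γ : ProperRay Y y₀) : ProperRay Y y₁ where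
  toFun := γ.toFun
  continuous_toFun := γ.continuous_toFun
  isBounded_preimage r hr := (γ.isBounded_preimage (r + dist y₁ y₀) (by positivity)).subset
    (preimage_mono (closedBall_subset_closedBall_add_dist y₀ y₁ r))

theorem ProperRay.SameEnd.changeBase {y₀ : Y} (y₁ : Y) {γ γ' : ProperRay Y y₀}
    (h : γ.SameEnd γ') : (γ.changeBase y₁).SameEnd (γ'.changeBase y₁) := fun r hr =>
  (h (r + dist y₁ y₀) (by positivity)).imp fun _ ht =>
    ht.mono_compl (closedBall_subset_closedBall_add_dist y₀ y₁ r)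

/-- The map of spaces of ends induced by a change of the base point. -/
def SpaceOfEnds.changeBase (y₀ y₁ : Y) : SpaceOfEnds Y y₀ → SpaceOfEnds Y y₁ :=
  Quotient.map' (ProperRay.changeBase y₁) fun _ _ h => ProperRay.SameEnd.changeBase y₁ h

theorem SpaceOfEnds.changeBase_changeBase (y₀ y₁ : Y) (e : SpaceOfEnds Y y₀) :
    changeBase y₁ y₀ (changeBase y₀ y₁ e) = e := by
  induction e using Quotient.inductionOn with
  | h γ => rfl

theorem SpaceOfEnds.ConvergesTo.changeBase {y₀ : Y} (y₁ : Y) {e : ℕ → SpaceOfEnds Y y₀}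
    {e' : SpaceOfEnds Y y₀} (h : ConvergesTo e e') :
    ConvergesTo (SpaceOfEnds.changeBase y₀ y₁ ∘ e) (SpaceOfEnds.changeBase y₀ y₁ e') := by
  obtain ⟨γ, γ', h1, h2, h3⟩ := h
  refine ⟨fun n => (γ n).changeBase y₁, γ'.changeBase y₁, fun n => ?_, ?_, fun r hr => ?_⟩
  · rw [Function.comp_apply, ← h1]
    rfl
  · rw [← h2]
    rfl
  · obtain ⟨N, hN⟩ := h3 (r + dist y₁ y₀) (by positivity)
    exact ⟨N, hN.mono fun n hn =>
      hn.mono_compl (closedBall_subset_closedBall_add_dist y₀ y₁ r)⟩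

/-- The space of ends does not depend on the base point. -/
def SpaceOfEnds.changeBaseHomeomorph (y₀ y₁ : Y) : SpaceOfEnds Y y₀ ≃ₜ SpaceOfEnds Y y₁ :=
  homeomorphOfConvergesTo
    ⟨changeBase y₀ y₁, changeBase y₁ y₀, changeBase_changeBase y₀ y₁, changeBase_changeBase y₁ y₀⟩
    (fun _ _ h => h.changeBase y₁) (fun _ _ h => h.changeBase y₀)

end BasePoint

/-! ### Ends as branches of a tree -/

section Concatenation

variable {Y : Type u} [TopologicalSpace Y]

/-- The infinite concatenation of paths. -/
noncomputable def concatPaths {y : ℕ → Y} (σ : ∀ n, Path (y n) (y (n + 1))) (t : ℝ≥0) : Y :=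
  (σ ⌊t⌋₊).extend ((t : ℝ) - ⌊t⌋₊)

theorem concatPaths_eq {y : ℕ → Y} (σ : ∀ n, Path (y n) (y (n + 1))) {n : ℕ} {t : ℝ≥0}
    (h1 : (n : ℝ≥0) ≤ t) (h2 : t ≤ n + 1) : concatPaths σ t = (σ n).extend ((t : ℝ) - n) := by
  -- At `t = n + 1` the floor already selects the next path, whose source is the target of the
  -- `n`-th.
  rcases h2.eq_or_lt with h | h
  · have : t = ((n + 1 : ℕ) : ℝ≥0) := by rw [h]; push_cast; rfl
    subst this
    rw [concatPaths, Nat.floor_natCast]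
    simp
  · rw [concatPaths, (Nat.floor_eq_iff (zero_le (a := t))).2 ⟨h1, h⟩]

theorem continuous_concatPaths {y : ℕ → Y} (σ : ∀ n, Path (y n) (y (n + 1))) :
    Continuous (concatPaths σ) := by
  have hlf : LocallyFinite fun n : ℕ => Icc (n : ℝ≥0) (n + 1) := by
    intro t
    refine ⟨Iio (⌊t⌋₊ + 1), Iio_mem_nhds (Nat.lt_floor_add_one t),
      (Set.finite_Iic ⌊t⌋₊).subset ?_⟩
    rintro n ⟨s, hs, hs'⟩
    have : (n : ℝ≥0) < ((⌊t⌋₊ + 1 : ℕ) : ℝ≥0) := by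
      push_cast
      exact hs.1.trans_lt hs'
    exact Nat.lt_succ_iff.1 (by exact_mod_cast this)
  refine hlf.continuous ?_ (fun n => isClosed_Icc) fun n => ?_
  · refine eq_univ_of_forall fun t => mem_iUnion.2 ⟨⌊t⌋₊, ?_, (Nat.lt_floor_add_one t).le⟩
    exact Nat.floor_le zero_le
  · have : Continuous fun t : ℝ≥0 => (σ n).extend ((t : ℝ) - n) :=
      (σ n).continuous_extend.comp (NNReal.continuous_coe.sub continuous_const)
    exact this.continuousOn.congr fun t ht => concatPaths_eq σ ht.1 ht.2

end Concatenation

theorem isPathConnected_Ici_nnreal (t : ℝ≥0) : IsPathConnected (Ici t) := by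
  have h0 : Real.toNNReal '' Ici (t : ℝ) = Ici t := by
    ext s
    simp only [mem_image, mem_Ici]
    constructor
    · rintro ⟨x, hx, rfl⟩
      exact NNReal.le_toNNReal_of_coe_le hx
    · intro hs
      exact ⟨s, NNReal.coe_le_coe.2 hs, Real.toNNReal_coe⟩
  rw [← h0]
  exact ((convex_Ici (t : ℝ)).isPathConnected nonempty_Ici).image continuous_real_toNNReal

theorem ProperRay.joinedIn_of_forall_ge {Y : Type u} [MetricSpace Y] {y₀ : Y} (γ : ProperRay Y y₀)
    {r : ℝ} {t s s' : ℝ≥0} (h : ∀ s, t ≤ s → γ.toFun s ∈ (closedBall y₀ r)ᶜ) (hs : t ≤ s)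
    (hs' : t ≤ s') : JoinedIn (closedBall y₀ r)ᶜ (γ.toFun s) (γ.toFun s') := by
  refine (((isPathConnected_Ici_nnreal t).image γ.continuous_toFun).joinedIn _ ⟨s, hs, rfl⟩ _
    ⟨s', hs', rfl⟩).mono ?_
  rintro _ ⟨s, hs, rfl⟩
  exact h s hs

/-- A tree whose vertices of level `n` are the path components of the complement of the closed ball
of radius `n - 1` in `Y` that contain points at distance at least `n` from the base point. -/
structure ComponentTree {V : Type v} (T : LeveledTree V) (Y : Type u) [MetricSpace Y] (y₀ : Y) where
  comp : ∀ (n : ℕ) (y : Y), n ≤ dist y y₀ → V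
  lev_comp : ∀ n y h, T.lev (comp n y h) = n
  exists_comp_eq : ∀ v, ∃ y h, comp (T.lev v) y h = v
  comp_eq_iff : ∀ n y h y' h',
    comp n y h = comp n y' h' ↔ JoinedIn (closedBall y₀ ((n : ℝ) - 1))ᶜ y y'
  par_comp : ∀ n y h h', T.par (comp (n + 1) y h) = comp n y h'

namespace LeveledTree

variable {V : Type v}

/-- The branches of a tree, that is, the infinite ascending paths from the root. -/
def Branch (T : LeveledTree V) : Type v :=
  {b : ℕ → V // (∀ n, T.lev (b n) = n) ∧ ∀ n, T.par (b (n + 1)) = b n}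

end LeveledTree

namespace ComponentTree

variable {V : Type v} {T : LeveledTree V} {Y : Type u} [MetricSpace Y] {y₀ : Y}
  (S : ComponentTree T Y y₀)

theorem le_dist_of_notMem {r : ℝ} {y : Y} (h : y ∈ (closedBall y₀ r)ᶜ) : r ≤ dist y y₀ :=
  (not_le.1 (mt mem_closedBall.2 h)).le

/-- Outside the ball of radius `n` a tail of the ray is connected and far enough out to define a
vertex of level `n`. Evaluating at one late time shows that successive vertices are parent and
child. -/
theorem exists_branch (γ : ProperRay Y y₀) : ∃ b : T.Branch, ∀ n, ∃ t : ℝ≥0, ∀ s, t ≤ s →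
    ∃ h, S.comp n (γ.toFun s) h = b.1 n := by
  choose t ht using fun n : ℕ => γ.exists_tail n n.cast_nonneg
  have key : ∀ n s, t n ≤ s → ∃ h, S.comp n (γ.toFun s) h =
      S.comp n (γ.toFun (t n)) (le_dist_of_notMem (ht n _ le_rfl)) := by
    intro n s hs
    refine ⟨le_dist_of_notMem (ht n _ hs), (S.comp_eq_iff _ _ _ _ _).2 ?_⟩
    exact (γ.joinedIn_of_forall_ge (ht n) hs le_rfl).mono
      (compl_subset_compl.2 (closedBall_subset_closedBall (by linarith)))
  refine ⟨⟨fun n => S.comp n (γ.toFun (t n)) (le_dist_of_notMem (ht n _ le_rfl)),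
    fun n => S.lev_comp _ _ _, fun n => ?_⟩, fun n => ⟨t n, key n⟩⟩
  obtain ⟨h, h'⟩ := key n (max (t n) (t (n + 1))) (le_max_left _ _)
  obtain ⟨k, k'⟩ := key (n + 1) (max (t n) (t (n + 1))) (le_max_right _ _)
  dsimp only
  rw [← h', ← k', S.par_comp _ _ _ h]

/-- The branch of the components that contain a tail of the proper ray. -/
noncomputable def rayBranch (γ : ProperRay Y y₀) : T.Branch := (S.exists_branch γ).choose

theorem rayBranch_spec (γ : ProperRay Y y₀) (n : ℕ) : ∃ t : ℝ≥0, ∀ s, t ≤ s →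
    ∃ h, S.comp n (γ.toFun s) h = (S.rayBranch γ).1 n :=
  (S.exists_branch γ).choose_spec n

theorem rayBranch_eq_of_inSamePathComponent {γ γ' : ProperRay Y y₀} {n : ℕ} {t : ℝ≥0}
    (h : InSamePathComponent y₀ n (γ.toFun '' Ici t) (γ'.toFun '' Ici t)) :
    (S.rayBranch γ).1 n = (S.rayBranch γ').1 n := by
  obtain ⟨t₁, h₁⟩ := S.rayBranch_spec γ n
  obtain ⟨t₂, h₂⟩ := S.rayBranch_spec γ' n
  set s := max t (max t₁ t₂)
  have hs : s ∈ Ici t := mem_Ici.2 (le_max_left _ _)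
  obtain ⟨k₁, e₁⟩ := h₁ s ((le_max_left _ _).trans (le_max_right _ _))
  obtain ⟨k₂, e₂⟩ := h₂ s ((le_max_right _ _).trans (le_max_right _ _))
  rw [← e₁, ← e₂, S.comp_eq_iff]
  exact (h.joinedIn ⟨s, hs, rfl⟩ ⟨s, hs, rfl⟩).mono
    (compl_subset_compl.2 (closedBall_subset_closedBall (by linarith)))

/-- Converse to the preceding lemma up to a loss of one in the radius, which is harmless since radii
are arbitrary. -/
theorem exists_inSamePathComponent {γ γ' : ProperRay Y y₀} {n : ℕ} {r : ℝ} (hr : r ≤ (n : ℝ) - 1)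
    (h : (S.rayBranch γ).1 n = (S.rayBranch γ').1 n) :
    ∃ t : ℝ≥0, InSamePathComponent y₀ r (γ.toFun '' Ici t) (γ'.toFun '' Ici t) := by
  obtain ⟨t₁, h₁⟩ := S.rayBranch_spec γ n
  obtain ⟨t₂, h₂⟩ := S.rayBranch_spec γ' n
  set t := max t₁ t₂
  obtain ⟨k, e⟩ := h₁ t (le_max_left _ _)
  have hsub : (closedBall y₀ ((n : ℝ) - 1))ᶜ ⊆ (closedBall y₀ r)ᶜ :=
    compl_subset_compl.2 (closedBall_subset_closedBall hr)
  refine ⟨t, γ.toFun t, hsub fun hmem => ?_, ?_, ?_⟩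
  · rw [mem_closedBall] at hmem
    linarith
  · rintro _ ⟨s, hs, rfl⟩
    obtain ⟨k', e'⟩ := h₁ s ((le_max_left _ _).trans hs)
    exact ((S.comp_eq_iff _ _ _ _ _).1 (e.trans e'.symm)).mono hsub
  · rintro _ ⟨s, hs, rfl⟩
    obtain ⟨k', e'⟩ := h₂ s ((le_max_right _ _).trans hs)
    exact ((S.comp_eq_iff _ _ _ _ _).1 (e.trans (h.trans e'.symm))).mono hsub

theorem sameEnd_iff {γ γ' : ProperRay Y y₀} :
    γ.SameEnd γ' ↔ S.rayBranch γ = S.rayBranch γ' := by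
  constructor
  · intro h
    refine Subtype.ext (funext fun n => ?_)
    obtain ⟨t, ht⟩ := h n n.cast_nonneg
    exact S.rayBranch_eq_of_inSamePathComponent ht
  · intro h r _
    obtain ⟨n, hn⟩ := exists_nat_ge (r + 1)
    exact S.exists_inSamePathComponent (n := n) (by linarith) (by rw [h])

/-- Representatives of consecutive vertices can be joined outside the ball of radius `n - 1`, since
the parent of the later vertex is the earlier one. Concatenating these paths gives a ray, proper
because its pieces leave every ball. -/
theorem exists_rayBranch_eq (b : T.Branch) : ∃ γ, S.rayBranch γ = b := by
  obtain ⟨b, hlev, hpar⟩ := b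
  have hex : ∀ n, ∃ y h, S.comp n y h = b n := fun n => by
    have := S.exists_comp_eq (b n)
    rwa [hlev] at this
  choose y hy hyb using hex
  have hle : ∀ n : ℕ, (n : ℝ) ≤ dist (y (n + 1)) y₀ := fun n => by
    have := hy (n + 1)
    push_cast at this
    linarith
  have hjoin : ∀ n : ℕ, JoinedIn (closedBall y₀ ((n : ℝ) - 1))ᶜ (y n) (y (n + 1)) := fun n => by
    rw [← S.comp_eq_iff n _ (hy n) _ (hle n), hyb, ← S.par_comp n _ (hy (n + 1)), hyb, hpar]
  set γ := concatPaths fun n => (hjoin n).somePath with hγ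
  have hγc : Continuous γ := continuous_concatPaths _
  have hγn : ∀ n : ℕ, γ n = y n := fun n => by
    rw [hγ, concatPaths_eq _ le_rfl (by simp)]
    simp
  have htail : ∀ (n : ℕ) (t : ℝ≥0), n ≤ t → γ t ∈ (closedBall y₀ ((n : ℝ) - 1))ᶜ := by
    intro n t hnt
    have hn : n ≤ ⌊t⌋₊ := Nat.le_floor hnt
    have hn' : (n : ℝ) ≤ ⌊t⌋₊ := by exact_mod_cast hn
    refine compl_subset_compl.2 (closedBall_subset_closedBall (by linarith))
      (?_ : γ t ∈ (closedBall y₀ ((⌊t⌋₊ : ℝ) - 1))ᶜ)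
    rw [hγ, concatPaths, Path.extend_apply]
    · exact (hjoin ⌊t⌋₊).somePath_mem _
    · have h1 := Nat.floor_le (zero_le (a := t))
      have h2 := (Nat.lt_floor_add_one t).le
      rw [← NNReal.coe_le_coe] at h1 h2
      push_cast at h1 h2
      exact ⟨by linarith, by linarith⟩
  set ρ : ProperRay Y y₀ := ⟨γ, hγc, fun r hr => by
    obtain ⟨n, hn⟩ := exists_nat_ge (r + 1)
    refine (isBounded_Icc (0 : ℝ≥0) n).subset fun t ht => ⟨zero_le, ?_⟩
    by_contra! hlt
    refine htail n t hlt.le (closedBall_subset_closedBall ?_ ht)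
    linarith⟩ with hρ
  refine ⟨ρ, Subtype.ext (funext fun n => ?_)⟩
  obtain ⟨t, ht⟩ := S.rayBranch_spec ρ n
  obtain ⟨k, e⟩ := ht (max t n) (le_max_left _ _)
  rw [← e]
  dsimp only
  rw [← hyb n, S.comp_eq_iff, ← hγn n]
  exact ρ.joinedIn_of_forall_ge (htail n) (le_max_right _ _) le_rfl

/-- The ends of `Y` are the branches of the tree of components. -/
noncomputable def endBranch : SpaceOfEnds Y y₀ ≃ T.Branch :=
  Equiv.ofBijective (Quotient.lift S.rayBranch fun _ _ h => S.sameEnd_iff.1 h) <| by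
    constructor
    · intro e e'
      induction e, e' using Quotient.inductionOn₂ with
      | h γ γ' => exact fun h => Quotient.sound (S.sameEnd_iff.2 h)
    · intro b
      obtain ⟨γ, h⟩ := S.exists_rayBranch_eq b
      exact ⟨γ.toEnd, h⟩

theorem endBranch_toEnd (γ : ProperRay Y y₀) : S.endBranch γ.toEnd = S.rayBranch γ := rfl

/-- The right-hand side mentions only branches, so the topology on ends is determined by the tree.
-/
theorem convergesTo_iff (e : ℕ → SpaceOfEnds Y y₀) (e' : SpaceOfEnds Y y₀) :
    SpaceOfEnds.ConvergesTo e e' ↔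
      ∀ n, ∀ᶠ k in atTop, (S.endBranch (e k)).1 n = (S.endBranch e').1 n := by
  constructor
  · rintro ⟨γ, γ', h1, rfl, h3⟩ n
    obtain ⟨N, hN⟩ := h3 n n.cast_nonneg
    refine hN.mono fun k hk => ?_
    rw [← h1, endBranch_toEnd, endBranch_toEnd]
    exact S.rayBranch_eq_of_inSamePathComponent hk
  · intro h
    choose γ hγ using fun k => Quotient.exists_rep (e k)
    obtain ⟨γ', rfl⟩ := Quotient.exists_rep e'
    refine ⟨γ, γ', hγ, rfl, fun r hr => ?_⟩
    obtain ⟨n, hn⟩ := exists_nat_ge (r + 1)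
    -- A time is needed for every index; `0` is a dummy value where the branches still differ at
    -- level `n`.
    have key : ∀ k, ∃ t : ℝ≥0, (S.rayBranch (γ k)).1 n = (S.rayBranch γ').1 n →
        InSamePathComponent y₀ r ((γ k).toFun '' Ici t) (γ'.toFun '' Ici t) := fun k => by
      by_cases hk : (S.rayBranch (γ k)).1 n = (S.rayBranch γ').1 n
      · obtain ⟨t, ht⟩ := S.exists_inSamePathComponent (by linarith) hk
        exact ⟨t, fun _ => ht⟩
      · exact ⟨0, fun h => absurd h hk⟩
    choose N hN using key
    refine ⟨N, (h n).mono fun k hk => hN k ?_⟩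
    rw [← hγ] at hk
    exact hk

/-- Two spaces with the same tree of components have homeomorphic spaces of ends. -/
noncomputable def homeomorph {Z : Type*} [MetricSpace Z] {z₀ : Z} (S : ComponentTree T Y y₀)
    (S' : ComponentTree T Z z₀) : SpaceOfEnds Y y₀ ≃ₜ SpaceOfEnds Z z₀ :=
  SpaceOfEnds.homeomorphOfConvergesTo (S.endBranch.trans S'.endBranch.symm)
    (fun e e' h => by
      rw [S'.convergesTo_iff]
      simpa using (S.convergesTo_iff e e').1 h)
    (fun e e' h => by
      rw [S.convergesTo_iff]
      simpa using (S'.convergesTo_iff e e').1 h)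

end ComponentTree

/-! ### The tree of components of a tree -/

namespace LeveledTree

variable {V : Type v} (T : LeveledTree V)

theorem vertex_injective {G : SimpleGraph V} (hG : G.Connected) :
    Function.Injective (MetricGraph.vertex hG) := by
  intro a b h
  by_contra hne
  have := congrFun (congrArg MetricGraph.coord h) a
  simp [MetricGraph.vertex, vertexCoord_self, vertexCoord_of_ne hne] at this

theorem ht_vertex (v : V) : T.ht (MetricGraph.vertex _ v : T.Realisation) = T.lev v := by
  rw [← T.ray_lev, T.ht_ray ⟨Nat.cast_nonneg _, le_rfl⟩]

/-- The descent from `p` stays at height at least `n`. -/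
theorem joinedIn_below {p : T.Realisation} {n : ℕ} (h : n ≤ T.ht p) :
    JoinedIn (closedBall T.rootPoint ((n : ℝ) - 1))ᶜ p (T.below p n) := by
  have hn : (0 : ℝ) ≤ n := n.cast_nonneg
  have hpc := ((convex_Icc (n : ℝ) (T.ht p)).isPathConnected (nonempty_Icc.2 h)).image'
    ((T.continuousOn_below p).mono (Icc_subset_Icc_left hn))
  have := hpc.joinedIn _ ⟨T.ht p, ⟨h, le_rfl⟩, rfl⟩ _ ⟨n, ⟨le_rfl, h⟩, rfl⟩
  rw [T.below_of_ht_le le_rfl] at this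
  refine this.mono ?_
  rintro _ ⟨s, hs, rfl⟩ hmem
  rw [mem_closedBall, T.dist_rootPoint, T.ht_below (hn.trans hs.1) hs.2] at hmem
  linarith [hs.1]

/-- By compactness the path stays above some height `s > n - 1`, so its truncation to `s` is locally
constant and hence constant. With `s ≤ n`, this common point determines the ancestor of level `n`.
-/
theorem anc_top_eq_of_joinedIn {p q : T.Realisation} {n : ℕ}
    (h : JoinedIn (closedBall T.rootPoint ((n : ℝ) - 1))ᶜ p q) :
    T.anc (T.top p) n = T.anc (T.top q) n := by
  rcases Nat.eq_zero_or_pos n with rfl | hn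
  · rw [T.eq_root (T.anc (T.top p) 0) (by simp [lev_anc]),
      T.eq_root (T.anc (T.top q) 0) (by simp [lev_anc])]
  obtain ⟨σ, hσ⟩ := h
  obtain ⟨t₀, -, ht₀⟩ := isCompact_univ.exists_isMinOn univ_nonempty
    (T.continuous_ht.comp σ.continuous).continuousOn
  have hn1 : (1 : ℝ) ≤ n := by exact_mod_cast hn
  have hmin : (n : ℝ) - 1 < min (T.ht (σ t₀)) n := by
    refine lt_min ?_ (by linarith)
    have := hσ t₀
    rwa [mem_compl_iff, mem_closedBall, T.dist_rootPoint, not_le] at this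
  obtain ⟨s, hs1, hs2⟩ := exists_between hmin
  have hs0 : 0 < s := by linarith
  have hlt : ∀ t, s < T.ht (σ t) := fun t =>
    (hs2.trans_le (min_le_left _ _)).trans_le (ht₀ (mem_univ t))
  have hloc : IsLocallyConstant fun t => T.below (σ t) s := by
    refine (IsLocallyConstant.iff_eventually_eq _).2 fun t => ?_
    filter_upwards [σ.continuous.continuousAt.preimage_mem_nhds
      (ball_mem_nhds (σ t) (sub_pos.2 (hlt t)))] with t' ht'
    rw [mem_preimage, mem_ball, dist_comm] at ht'
    exact (T.below_eq_of_dist_lt ht').symm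
  have heq := hloc.apply_eq_of_preconnectedSpace 0 1
  have hp := hlt 0
  have hq := hlt 1
  simp only [σ.source, σ.target] at heq hp hq
  rw [below, below, min_eq_left hp.le, min_eq_left hq.le] at heq
  have hceil : ⌈s⌉₊ = n := by
    rw [Nat.ceil_eq_iff (by omega), Nat.cast_sub hn, Nat.cast_one]
    exact ⟨hs1, (hs2.trans_le (min_le_right _ _)).le⟩
  rw [← hceil]
  exact (T.ray_injective ⟨hs0.le, hp.le.trans (T.ht_mem p).2⟩
    ⟨hs0.le, hq.le.trans (T.ht_mem q).2⟩ heq).2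

/-- A tree is the tree of components of its own realisation. -/
noncomputable def componentTree : ComponentTree T T.Realisation T.rootPoint where
  comp n p _ := T.anc (T.top p) n
  lev_comp n p h := by
    rw [T.dist_rootPoint] at h
    rw [lev_anc, min_eq_left]
    exact_mod_cast h.trans (T.ht_mem p).2
  exists_comp_eq v := by
    refine ⟨MetricGraph.vertex _ v, by rw [T.dist_rootPoint, T.ht_vertex], ?_⟩
    refine vertex_injective T.graph_connected ?_
    rw [← T.below_natCast (T.ht_vertex v).ge, T.below_of_ht_le (T.ht_vertex v).le]
  comp_eq_iff n p h q h' := by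
    rw [T.dist_rootPoint] at h h'
    refine ⟨fun heq => ?_, T.anc_top_eq_of_joinedIn⟩
    have hp := T.joinedIn_below h
    have hq := T.joinedIn_below h'
    rw [T.below_natCast h, heq, ← T.below_natCast h'] at hp
    exact hp.trans hq.symm
  par_comp n p h _ := by
    rw [T.dist_rootPoint] at h
    refine T.par_anc (Nat.lt_of_succ_le ?_)
    exact_mod_cast h.trans (T.ht_mem p).2

/-- The tree with a single vertex. -/
def trivial : LeveledTree PUnit.{v + 1} where
  root := PUnit.unit
  par := id
  lev _ := 0
  lev_root := rfl
  lev_par _ := rfl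
  eq_root _ _ := rfl

end LeveledTree

/-! ### The tree of components of a geodesic space -/

section Geodesic

variable {X : Type u} [MetricSpace X]

theorem IsGeodesicFromTo.joinedIn {α : ℝ → X} {x y : X} (h : IsGeodesicFromTo α x y) {t : ℝ}
    (ht : t ∈ Icc 0 (dist x y)) {F : Set X} (hF : ∀ s ∈ Icc 0 t, α s ∈ F) :
    JoinedIn F x (α t) := by
  have hc : ContinuousOn α (Icc 0 t) := by
    refine LipschitzOnWith.continuousOn (K := 1)
      (LipschitzOnWith.of_dist_le_mul fun a ha b hb => ?_)
    rw [h.2.2 a ⟨ha.1, ha.2.trans ht.2⟩ b ⟨hb.1, hb.2.trans ht.2⟩, NNReal.coe_one, one_mul,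
      Real.dist_eq]
  have hpc := ((convex_Icc 0 t).isPathConnected (nonempty_Icc.2 ht.1)).image' hc
  have := hpc.joinedIn _ ⟨0, ⟨le_rfl, ht.1⟩, rfl⟩ _ ⟨t, ⟨ht.1, le_rfl⟩, rfl⟩
  rw [h.1] at this
  exact this.mono (image_subset_iff.2 hF)

/-- By the triangle inequality the geodesic is too short to reach the ball. -/
theorem IsGeodesicSpace.joinedIn_of_dist_lt (hX : IsGeodesicSpace X) {x₀ x y : X} {r : ℝ}
    (h : dist x y < dist x x₀ - r) : JoinedIn (closedBall x₀ r)ᶜ x y := by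
  obtain ⟨α, hα⟩ := hX x y
  have := hα.joinedIn (t := dist x y) ⟨dist_nonneg, le_rfl⟩ (F := (closedBall x₀ r)ᶜ)
    fun s hs hmem => by
      have h1 := hα.2.2 0 ⟨le_rfl, dist_nonneg⟩ s hs
      rw [hα.1, zero_sub, abs_neg, abs_of_nonneg hs.1] at h1
      linarith [dist_triangle x (α s) x₀, hs.2, mem_closedBall.1 hmem]
  rwa [hα.2.1] at this

/-- A point at distance at least `n` can be moved towards `x₀` to distance `n`. -/
theorem IsGeodesicSpace.exists_joinedIn_sphere (hX : IsGeodesicSpace X) {x₀ x : X} {r R : ℝ}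
    (hrR : r < R) (hR : 0 ≤ R) (h : R ≤ dist x x₀) :
    ∃ y ∈ sphere x₀ R, JoinedIn (closedBall x₀ r)ᶜ x y := by
  obtain ⟨α, hα⟩ := hX x x₀
  have hd : ∀ s ∈ Icc 0 (dist x x₀ - R), dist (α s) x₀ = dist x x₀ - s := fun s hs => by
    have h1 := hα.2.2 s ⟨hs.1, by linarith [hs.2]⟩ (dist x x₀) ⟨dist_nonneg, le_rfl⟩
    rwa [hα.2.1, abs_sub_comm, abs_of_nonneg (by linarith [hs.2])] at h1
  refine ⟨α (dist x x₀ - R), ?_, hα.joinedIn ⟨by linarith, by linarith⟩ fun s hs hmem => ?_⟩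
  · rw [mem_sphere, hd _ ⟨by linarith, le_rfl⟩]
    ring
  · rw [mem_closedBall, hd s hs] at hmem
    linarith [hs.2]

/-- Points `(n, x)` with `x` at distance at least `n` from `x₀`, up to paths outside the ball of
radius `n - 1`. -/
def componentSetoid (x₀ : X) : Setoid {p : ℕ × X // p.1 ≤ dist p.2 x₀} where
  r p q := p.1.1 = q.1.1 ∧ JoinedIn (closedBall x₀ ((p.1.1 : ℝ) - 1))ᶜ p.1.2 q.1.2
  iseqv :=
    { refl := fun p => ⟨rfl, JoinedIn.refl fun h => by
        have := p.2
        rw [mem_closedBall] at h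
        linarith⟩
      symm := fun h => ⟨h.1.symm, by rw [← h.1]; exact h.2.symm⟩
      trans := fun h h' => ⟨h.1.trans h'.1, h.2.trans (by rw [h.1]; exact h'.2)⟩ }

/-- The vertices of the tree of components. -/
def ComponentVertex (x₀ : X) : Type u := Quotient (componentSetoid x₀)

/-- The component of `x` outside the ball of radius `n - 1`. -/
def ComponentVertex.mk {x₀ : X} (n : ℕ) (x : X) (h : n ≤ dist x x₀) : ComponentVertex x₀ :=
  Quotient.mk (componentSetoid x₀) ⟨(n, x), h⟩

theorem ComponentVertex.mk_eq_iff {x₀ : X} {n : ℕ} {x y : X} {h : n ≤ dist x x₀}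
    {h' : n ≤ dist y x₀} :
    mk n x h = mk n y h' ↔ JoinedIn (closedBall x₀ ((n : ℝ) - 1))ᶜ x y :=
  Quotient.eq.trans (and_iff_right rfl)

theorem natCast_sub_one_le (n : ℕ) : ((n - 1 : ℕ) : ℝ) ≤ n := by
  exact_mod_cast Nat.sub_le n 1

/-- The tree of components of the complements of balls in a geodesic space. -/
def IsGeodesicSpace.tree (hX : IsGeodesicSpace X) (x₀ : X) : LeveledTree (ComponentVertex x₀) where
  root := ComponentVertex.mk 0 x₀ (by simp)
  -- The representative is kept and only the level drops; truncated subtraction makes the root its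
  -- own parent.
  par := Quotient.map (fun p => ⟨(p.1.1 - 1, p.1.2), (natCast_sub_one_le _).trans p.2⟩)
    fun p q h => ⟨congrArg (· - 1) h.1, h.2.mono (compl_subset_compl.2
      (closedBall_subset_closedBall (sub_le_sub_right (natCast_sub_one_le _) _)))⟩
  lev := Quotient.lift (fun p => p.1.1) fun _ _ h => h.1
  lev_root := rfl
  lev_par v := by
    induction v using Quotient.inductionOn with
    | h p => rfl
  eq_root v hv := by
    induction v using Quotient.inductionOn with
    | h p =>
      obtain ⟨⟨n, x⟩, hp⟩ := p
      obtain rfl : n = 0 := hv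
      refine ComponentVertex.mk_eq_iff.2 (JoinedIn.symm ?_)
      -- At level `0` the excluded ball has radius `-1` and is empty, and the sphere of radius `0`
      -- is the base point.
      obtain ⟨y, hy, hxy⟩ := hX.exists_joinedIn_sphere (x := x) (x₀ := x₀) (r := ((0 : ℕ) : ℝ) - 1)
        (by simp) le_rfl dist_nonneg
      rw [sphere_zero, mem_singleton_iff] at hy
      exact hy ▸ hxy.symm

/-- The components of a geodesic space form its tree of components. -/
def IsGeodesicSpace.componentTree (hX : IsGeodesicSpace X) (x₀ : X) :
    ComponentTree (hX.tree x₀) X x₀ where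
  comp := ComponentVertex.mk
  lev_comp _ _ _ := rfl
  exists_comp_eq v := by
    induction v using Quotient.inductionOn with
    | h p => exact ⟨p.1.2, p.2, rfl⟩
  comp_eq_iff _ _ _ _ _ := ComponentVertex.mk_eq_iff
  par_comp _ _ _ _ := rfl

/-- Each vertex of level `n` has a representative on the compact sphere of radius `n`, where the
vertex is locally constant: the gap between `n - 1` and `n` lets points less than `1` apart be
joined. -/
theorem IsGeodesicSpace.finite_lev_eq [ProperSpace X] (hX : IsGeodesicSpace X) (x₀ : X) (n : ℕ) :
    {v | (hX.tree x₀).lev v = n}.Finite := by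
  have hloc : IsLocallyConstant fun x : sphere x₀ (n : ℝ) =>
      ComponentVertex.mk n x.1 (mem_sphere.1 x.2).ge := by
    refine (IsLocallyConstant.iff_eventually_eq _).2 fun x => ?_
    filter_upwards [ball_mem_nhds x one_pos] with y hy
    refine (ComponentVertex.mk_eq_iff.2 (hX.joinedIn_of_dist_lt ?_)).symm
    rw [mem_sphere.1 x.2, sub_sub_cancel, dist_comm]
    exact hy
  have : CompactSpace (sphere x₀ (n : ℝ)) := isCompact_iff_compactSpace.1 (isCompact_sphere _ _)
  refine hloc.range_finite.subset fun v hv => ?_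
  induction v using Quotient.inductionOn with
  | h p =>
    obtain ⟨⟨m, x⟩, hp⟩ := p
    obtain rfl : m = n := hv
    obtain ⟨y, hy, hxy⟩ := hX.exists_joinedIn_sphere (r := (m : ℝ) - 1) (by linarith)
      m.cast_nonneg hp
    exact ⟨⟨y, hy⟩, ComponentVertex.mk_eq_iff.2 hxy.symm⟩

end Geodesic

theorem mainTheorem12 {X : Type u} [MetricSpace X] [ProperSpace X] (hX : IsGeodesicSpace X) :
    ∃ (V : Type u) (G : SimpleGraph V) (hG : G.Connected),
      IsRTree (MetricGraph G hG) ∧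
      (∀ a : V, (G.neighborSet a).Finite) ∧
      ∀ (x₀ : X) (t₀ : MetricGraph G hG),
        Nonempty (SpaceOfEnds X x₀ ≃ₜ SpaceOfEnds (MetricGraph G hG) t₀) := by
  -- An empty space has no base points, so any tree serves. Otherwise the tree is built from one
  -- point `o`, and other base points are reached by change of base.
  rcases isEmpty_or_nonempty X with hE | ⟨⟨o⟩⟩
  · exact ⟨PUnit, LeveledTree.trivial.graph, LeveledTree.trivial.graph_connected,
      LeveledTree.trivial.isRTree, fun _ => Set.toFinite _, fun x₀ => (hE.false x₀).elim⟩
  · refine ⟨ComponentVertex o, (hX.tree o).graph, (hX.tree o).graph_connected,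
      (hX.tree o).isRTree, (hX.tree o).finite_neighborSet (hX.finite_lev_eq o), fun x₀ t₀ => ⟨?_⟩⟩
    exact (SpaceOfEnds.changeBaseHomeomorph x₀ o).trans
      (((hX.componentTree o).homeomorph (hX.tree o).componentTree).trans
        (SpaceOfEnds.changeBaseHomeomorph _ t₀))
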